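/- **Proposition (Admissible numbers of generators of an ideal with a given Hilbert function).** Let $k$ be a field of characteristic $0$, let $R=k[[x,y]]$ and let $\mathfrak m=(x,y)$. For a proper ideal $J\subset R$ with $\dim_k R/J<\infty$, let $\operatorname{HF}_{R/J}(i)=\dim_k \mathfrak n^i/\mathfrak n^{i+1}$ $(i\ge 0)$ be the Hilbert function of $R/J$, where $\mathfrak n=\mathfrak m/J$; let $\mu(J)$ be the minimal number of generators of $J$, and let $\operatorname{ord}(J)$ be the order (initial degree) of $J$, i.e. the smallest order of a nonzero power series in $J$. Say that $h:\mathbb N\to\mathbb N$ is admissible of order $t\ge 1$ if $h=(1,2,\dots,t,h_t,h_{t+1},\dots,h_s,0,0,\dots)$ with $t\ge h_t\ge h_{t+1}\ge\dots\ge h_s$, and put $\Delta(h)=\max_{i\ge 1}|h_i-h_{i-1}|$, where the jump from the last nonzero value of $h$ to $0$ is included. Then: 1. If $J\subset R$ is a proper ideal of finite colength with $\operatorname{HF}_{R/J}=h$ and $t=\operatorname{ord}(J)$, then $h$ is admissible of order $t$ and $\Delta(h)<\mu(J)\le t+1$. 2. Conversely, if $h$ is admissible of order $t$, then for every integer $d$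 with $\Delta(h)<d\le t+1$ there is a proper ideal $J\subset R$ of finite colength with $\operatorname{HF}_{R/J}=h$, $\operatorname{ord}(J)=t$ and $\mu(J)=d$. -/

import Mathlib

noncomputable section

namespace PowerSeriesIdeal

/-- The ring `k[[x, y]]` of formal power series in two variables. -/
abbrev R (k : Type*) [Field k] : Type _ := MvPowerSeries (Fin 2) k

/-- The image in `k[[x, y]] / J` of the maximal ideal `(x, y)`; for a proper ideal `J` this is the
maximal ideal of the local ring `k[[x, y]] / J`. -/
def maxIdealQuot {k : Type*} [Field k] (J : Ideal (R k)) : Ideal (R k ⧸ J) :=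
  (IsLocalRing.maximalIdeal (R k)).map (Ideal.Quotient.mk J)

/-- The Hilbert function of `A = k[[x, y]] / J`: with `n` the maximal ideal of `A`, its value at `i`
is the `k`-dimension of `n ^ i / n ^ (i + 1)`, written as `n ^ i` modulo `n • n ^ i`. -/
def hilbertFunction {k : Type*} [Field k] (J : Ideal (R k)) (i : ℕ) : ℕ :=
  Module.finrank k
    (↥(maxIdealQuot J ^ i) ⧸
      (maxIdealQuot J • ⊤ : Submodule (R k ⧸ J) ↥(maxIdealQuot J ^ i)))

/-- `J` is a zero-dimensional ideal: proper and of finite colength. -/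
def IsZeroDimensional {k : Type*} [Field k] (J : Ideal (R k)) : Prop :=
  J ≠ ⊤ ∧ Module.Finite k (R k ⧸ J)

/-- The order (initial degree) of an ideal `J`: the smallest order of a nonzero element of `J`. -/
def idealOrder {k : Type*} [Field k] (J : Ideal (R k)) : ℕ :=
  sInf {n : ℕ | ∃ f ∈ J, MvPowerSeries.order f = (n : ℕ∞)}

/-- The minimal number of generators of an ideal. -/
def minGenerators {k : Type*} [Field k] (J : Ideal (R k)) : ℕ :=
  Submodule.spanFinrank J

/-- `h = (1, 2, …, t, h_t, h_{t+1}, …, h_s, 0, 0, …)` with `t ≥ 1` and `t ≥ h_t ≥ h_{t+1} ≥ …`. -/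
def IsAdmissible (h : ℕ → ℕ) (t : ℕ) : Prop :=
  1 ≤ t ∧ (∀ i < t, h i = i + 1) ∧ (∀ i, t ≤ i + 1 → h (i + 1) ≤ h i) ∧ ∃ s, ∀ i > s, h i = 0

/-- The maximal jump `max_{i ≥ 1} |h_i - h_{i-1}|` of an eventually zero sequence `h`
(the jump from the last nonzero value to `0` is included). -/
def maxJump (h : ℕ → ℕ) : ℕ :=
  ⨆ i : ℕ, ((h (i + 1) : ℤ) - (h i : ℤ)).natAbs

end PowerSeriesIdeal

end

namespace PowerSeriesIdeal

open Module

/-! ### Multiplication by one element on a finite-dimensional algebra -/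

section Artinian

variable {k : Type*} [Field k]

/-! Let `A = R/J` with maximal ideal `n`. The Koszul complex of `x, y` on `A` has Euler
characteristic zero and first homology `J/mJ`, so `μ(J)` is one more than the socle dimension of `A`
(`finrank_ideal_quotient_eq_finrank_pairSocle_add_one`). Both halves thus become statements about
the socle.

Bounds: `J` contains a series of order `t`; as `k` is infinite, some `z = x - cy` satisfies `n^t ⊆ z
n^(t-1)` (`exists_linearForm`). For `i ≥ t-1`, multiplication by `z` maps `n^i` onto `n^(i+1)`, so
its kernel `K_i` has dimension `h_i`. Since `K_(i+1) ⊆ K_i`, the tail of `h` is nonincreasing. Since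
`y` maps `K_i` into `K_(i+1)` with kernel inside the socle, each drop is at most the socle
dimension. Finally the socle lies in the annihilator of `z`, whose dimension is that of `A/zA`, at
most `t`.

Existence: put `δ = d - 1` and take a vector space with one basis box `(a, i)` for each `a < h_i`.
Let `y` raise the degree within a column, and let `x` move to the next column plus a term going `δ`
columns back that keeps the distance to the column top. Because `δ` bounds the jumps, that term
strictly raises the degree (`IsAdmissible.colTop_lt`), so `x` and `y` are commuting nilpotent
operators. The space is cyclic, with the degree filtration as its `m`-adic one
(`map_orbitMap_maximalIdeal_pow`). The socle is spanned by the tops of the first `δ` columns,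
because `x` sends every later top to the top `δ` columns back (`finrank_ker_actX_inf_ker_actY`). The
required ideal is the annihilator of the box `(0, 0)`. -/

lemma finrank_map_add_finrank_inf_ker {V W : Type*} [AddCommGroup V] [Module k V]
    [AddCommGroup W] [Module k W] [Module.Finite k V] (f : V →ₗ[k] W) (p : Submodule k V) :
    finrank k (p.map f) + finrank k ↥(p ⊓ LinearMap.ker f) = finrank k p := by
  have h := LinearMap.finrank_range_add_finrank_ker (f.domRestrict p)
  rw [LinearMap.range_domRestrict, LinearMap.ker_domRestrict] at h
  rw [← h, ← Submodule.map_comap_subtype p (LinearMap.ker f), Submodule.finrank_map_subtype_eq]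

variable {A : Type*} [CommRing A] [Algebra k A]

lemma finrank_pow_quotient_add [Module.Finite k A] (n : Ideal A) (i : ℕ) :
    finrank k (↥(n ^ i) ⧸ (n • ⊤ : Submodule A ↥(n ^ i))) + finrank k ↥(n ^ (i + 1)) =
      finrank k ↥(n ^ i) := by
  have : Module.Finite k ↥(n ^ i) :=
    inferInstanceAs (Module.Finite k ((n ^ i).restrictScalars k))
  have h := Submodule.finrank_quotient_add_finrank
    ((n • ⊤ : Submodule A ↥(n ^ i)).restrictScalars k)
  rw [(Submodule.Quotient.restrictScalarsEquiv k (n • ⊤ : Submodule A ↥(n ^ i))).finrank_eq] at h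
  rw [← h]
  congr 1
  have hmap : (n • ⊤ : Submodule A ↥(n ^ i)).map (n ^ i).subtype = n ^ (i + 1) := by
    rw [Submodule.map_smul'', Submodule.map_top, Submodule.range_subtype, pow_succ', smul_eq_mul]
  have e := (Submodule.equivMapOfInjective (n ^ i).subtype (Submodule.subtype_injective _)
    (n • ⊤ : Submodule A ↥(n ^ i)))
  rw [hmap] at e
  exact (e.restrictScalars k).finrank_eq.symm

/-- The annihilator of two elements, as a `k`-subspace. -/
def pairSocle (k : Type*) [Field k] {A : Type*} [CommRing A] [Algebra k A] (z w : A) :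
    Submodule k A :=
  LinearMap.ker (LinearMap.mulLeft k z) ⊓ LinearMap.ker (LinearMap.mulLeft k w)

lemma map_mulLeft_pow_restrictScalars {n : Ideal A} {z : A} (hz : z ∈ n) {i : ℕ}
    (h : n ^ (i + 1) ≤ Ideal.span {z} * n ^ i) :
    ((n ^ i).restrictScalars k).map (LinearMap.mulLeft k z) =
      (n ^ (i + 1)).restrictScalars k := by
  ext a
  simp only [Submodule.mem_map, Submodule.restrictScalars_mem, LinearMap.mulLeft_apply]
  constructor
  · rintro ⟨b, hb, rfl⟩
    rw [pow_succ']
    exact Ideal.mul_mem_mul hz hb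
  · intro ha
    obtain ⟨b, hb, rfl⟩ := Ideal.mem_span_singleton_mul.1 (h ha)
    exact ⟨b, hb, rfl⟩

/-- Rank-nullity for `z : n^i → n^(i+1)`, which is onto. With `finrank_pow_quotient_add`, the kernel
has the dimension of `n^i / n^(i+1)`. -/
lemma finrank_pow_inf_ker [Module.Finite k A] {n : Ideal A} {z : A} (hz : z ∈ n) {i : ℕ}
    (h : n ^ (i + 1) ≤ Ideal.span {z} * n ^ i) :
    finrank k ↥((n ^ i).restrictScalars k ⊓ LinearMap.ker (LinearMap.mulLeft k z)) +
      finrank k ↥(n ^ (i + 1)) = finrank k ↥(n ^ i) := by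
  have := finrank_map_add_finrank_inf_ker (LinearMap.mulLeft k z) ((n ^ i).restrictScalars k)
  rw [map_mulLeft_pow_restrictScalars hz h, add_comm] at this
  exact this

lemma pow_succ_le_span_mul_pow {n : Ideal A} {z : A} {s : ℕ}
    (h : n ^ (s + 1) ≤ Ideal.span {z} * n ^ s) {i : ℕ} (hi : s ≤ i) :
    n ^ (i + 1) ≤ Ideal.span {z} * n ^ i := by
  obtain ⟨j, rfl⟩ := Nat.exists_eq_add_of_le hi
  calc n ^ (s + j + 1) = n ^ (s + 1) * n ^ j := by rw [← pow_add]; congr 1; ring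
    _ ≤ Ideal.span {z} * n ^ s * n ^ j := Ideal.mul_mono_left h
    _ = _ := by rw [mul_assoc, ← pow_add]

lemma finrank_quotient_succ_le [Module.Finite k A] {n : Ideal A} {z : A} (hz : z ∈ n) {s : ℕ}
    (h : n ^ (s + 1) ≤ Ideal.span {z} * n ^ s) {i : ℕ} (hi : s ≤ i) :
    finrank k (↥(n ^ (i + 1)) ⧸ (n • ⊤ : Submodule A ↥(n ^ (i + 1)))) ≤
      finrank k (↥(n ^ i) ⧸ (n • ⊤ : Submodule A ↥(n ^ i))) := by
  have h1 := finrank_pow_inf_ker (k := k) hz (pow_succ_le_span_mul_pow h hi)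
  have h2 := finrank_pow_inf_ker (k := k) hz (pow_succ_le_span_mul_pow h (hi.trans (Nat.le_add_right i 1)))
  have h3 := finrank_pow_quotient_add (k := k) n i
  have h4 := finrank_pow_quotient_add (k := k) n (i + 1)
  have : finrank k ↥((n ^ (i + 1)).restrictScalars k ⊓ LinearMap.ker (LinearMap.mulLeft k z)) ≤
      finrank k ↥((n ^ i).restrictScalars k ⊓ LinearMap.ker (LinearMap.mulLeft k z)) :=
    Submodule.finrank_mono (inf_le_inf_right _ fun a ha => Ideal.pow_le_pow_right (Nat.le_add_right i 1) ha)
  omega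

/-- Multiplication by `w` sends the kernel of `z` on `n^i` into the kernel on `n^(i+1)`, and what it
kills is annihilated by both `z` and `w`. -/
lemma finrank_quotient_le_succ_add [Module.Finite k A] {n : Ideal A} {z w : A} (hz : z ∈ n)
    (hw : w ∈ n) {s : ℕ} (h : n ^ (s + 1) ≤ Ideal.span {z} * n ^ s) {i : ℕ} (hi : s ≤ i) :
    finrank k (↥(n ^ i) ⧸ (n • ⊤ : Submodule A ↥(n ^ i))) ≤
      finrank k (↥(n ^ (i + 1)) ⧸ (n • ⊤ : Submodule A ↥(n ^ (i + 1)))) +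
        finrank k (pairSocle k z w) := by
  have h1 := finrank_pow_inf_ker (k := k) hz (pow_succ_le_span_mul_pow h hi)
  have h2 := finrank_pow_inf_ker (k := k) hz (pow_succ_le_span_mul_pow h (hi.trans (Nat.le_add_right i 1)))
  have h3 := finrank_pow_quotient_add (k := k) n i
  have h4 := finrank_pow_quotient_add (k := k) n (i + 1)
  have h5 := finrank_map_add_finrank_inf_ker (LinearMap.mulLeft k w)
    ((n ^ i).restrictScalars k ⊓ LinearMap.ker (LinearMap.mulLeft k z))
  have h6 : finrank k ↥(((n ^ i).restrictScalars k ⊓ LinearMap.ker (LinearMap.mulLeft k z)).map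
      (LinearMap.mulLeft k w)) ≤
      finrank k ↥((n ^ (i + 1)).restrictScalars k ⊓ LinearMap.ker (LinearMap.mulLeft k z)) := by
    refine Submodule.finrank_mono ?_
    rintro _ ⟨a, ⟨ha, hza⟩, rfl⟩
    refine ⟨?_, ?_⟩
    · change w * a ∈ n ^ (i + 1)
      rw [pow_succ']
      exact Ideal.mul_mem_mul hw ha
    · have hza' : z * a = 0 := hza
      change z * (w * a) = 0
      rw [mul_left_comm, hza', mul_zero]
  have h7 : finrank k ↥((n ^ i).restrictScalars k ⊓ LinearMap.ker (LinearMap.mulLeft k z) ⊓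
      LinearMap.ker (LinearMap.mulLeft k w)) ≤ finrank k (pairSocle k z w) :=
    Submodule.finrank_mono (inf_le_inf_right _ inf_le_right)
  omega

/-- The kernel and cokernel of `z` have equal dimension, and `A/zA` is spanned by `1, w, …,
w^(t-1)`. -/
lemma finrank_pairSocle_le [Module.Finite k A] {n : Ideal A} {z w : A}
    (hn : n = Ideal.span {z, w}) (hA : ∀ a : A, ∃ c : k, a - algebraMap k A c ∈ n) {t : ℕ}
    (ht : n ^ t ≤ Ideal.span {z}) : finrank k (pairSocle k z w) ≤ t := by
  -- Expansion in powers of `w` modulo `z`. The remainder is recorded twice: as a multiple of `w^i`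
  -- to drive the induction, and as an element of `n^i` for use at `i = t`.
  have hspan : ∀ i : ℕ, ∀ a : A, ∃ p ∈ Submodule.span k (Set.range fun j : Fin i => w ^ (j : ℕ)),
      ∃ b : A, a - p - z * b ∈ n ^ i ∧ ∃ b' : A, a - p - z * b = w ^ i * b' := by
    intro i
    induction i with
    | zero => exact fun a => ⟨0, zero_mem _, 0, by simp, a, by simp⟩
    | succ i ih =>
      intro a
      obtain ⟨p, hp, b, -, b', hb'⟩ := ih a
      obtain ⟨c, hc⟩ := hA b'
      rw [hn, Ideal.mem_span_pair] at hc
      obtain ⟨u, v, huv⟩ := hc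
      have key : a - (p + c • w ^ i) - z * (b + w ^ i * u) = w ^ (i + 1) * v := by
        rw [Algebra.smul_def]
        linear_combination hb' - w ^ i * huv
      refine ⟨p + c • w ^ i, add_mem ?_ (Submodule.smul_mem _ _ (Submodule.subset_span
        ⟨Fin.last i, rfl⟩)), b + w ^ i * u, ?_, v, key⟩
      · refine Submodule.span_mono ?_ hp
        rintro _ ⟨j, rfl⟩
        exact ⟨j.castSucc, rfl⟩
      · rw [key]
        exact Ideal.mul_mem_right _ _ (Ideal.pow_mem_pow
          (hn ▸ Ideal.subset_span (by simp)) _)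
  have htop : (⊤ : Submodule k A) ≤ LinearMap.range (LinearMap.mulLeft k z) ⊔
      Submodule.span k (Set.range fun j : Fin t => w ^ (j : ℕ)) := by
    intro a _
    obtain ⟨p, hp, b, hb, -⟩ := hspan t a
    obtain ⟨b', hb'⟩ := Ideal.mem_span_singleton'.1 (ht hb)
    have : a = z * (b + b') + p := by linear_combination -hb'
    rw [this]
    exact Submodule.add_mem_sup ⟨b + b', rfl⟩ hp
  have h1 := LinearMap.finrank_range_add_finrank_ker (LinearMap.mulLeft k z)
  have h2 := (Submodule.finrank_mono htop).trans
    (Submodule.finrank_add_le_finrank_add_finrank _ _)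
  rw [finrank_top] at h2
  have h3 : finrank k (Submodule.span k (Set.range fun j : Fin t => w ^ (j : ℕ))) ≤ t := by
    have := finrank_range_le_card (R := k) (fun j : Fin t => w ^ (j : ℕ))
    rwa [Fintype.card_fin] at this
  have h4 : finrank k (pairSocle k z w) ≤ finrank k (LinearMap.ker (LinearMap.mulLeft k z)) :=
    Submodule.finrank_mono inf_le_left
  omega

end Artinian

/-! ### Koszul homology and the number of generators -/

section Koszul

variable {k R : Type*} [Field k] [CommRing R] [Algebra k R]

/-- The linear map `(a, b) ↦ x a + y b`. -/
def pairSum (k : Type*) [Field k] {R : Type*} [CommRing R] [Algebra k R] (x y : R) :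
    R × R →ₗ[k] R :=
  (LinearMap.mulLeft k x).coprod (LinearMap.mulLeft k y)

/-- The Koszul map `c ↦ (y c, -x c)`. -/
def pairSyzygy (k : Type*) [Field k] {R : Type*} [CommRing R] [Algebra k R] (x y : R) :
    R →ₗ[k] R × R :=
  (LinearMap.mulLeft k y).prod (-LinearMap.mulLeft k x)

@[simp] lemma pairSum_apply (x y : R) (p : R × R) : pairSum k x y p = x * p.1 + y * p.2 := by
  simp [pairSum]

@[simp] lemma pairSyzygy_apply (x y c : R) : pairSyzygy k x y c = (y * c, -(x * c)) := rfl

lemma ker_pairSyzygy (x y : R) : LinearMap.ker (pairSyzygy k x y) = pairSocle k x y := by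
  ext c
  simp [pairSocle, and_comm]

/-- The Koszul complex `R → R² → R` has Euler characteristic zero, so `dim H₁ = dim H₂ + dim H₀`,
where `H₂` is the socle and `H₀` is one-dimensional. -/
lemma finrank_map_mkQ_ker_pairSum [Module.Finite k R] (x y : R)
    (h : finrank k (R ⧸ LinearMap.range (pairSum k x y)) = 1) :
    finrank k ((LinearMap.ker (pairSum k x y)).map (LinearMap.range (pairSyzygy k x y)).mkQ) =
      finrank k (pairSocle k x y) + 1 := by
  have h1 := finrank_map_add_finrank_inf_ker (LinearMap.range (pairSyzygy k x y)).mkQ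
    (LinearMap.ker (pairSum k x y))
  have hle : LinearMap.range (pairSyzygy k x y) ≤ LinearMap.ker (pairSum k x y) := by
    rintro _ ⟨c, rfl⟩
    simp only [LinearMap.mem_ker, pairSum_apply, pairSyzygy_apply]
    ring
  rw [Submodule.ker_mkQ, inf_eq_right.2 hle] at h1
  have h2 := LinearMap.finrank_range_add_finrank_ker (pairSum k x y)
  have h3 := LinearMap.finrank_range_add_finrank_ker (pairSyzygy k x y)
  have h4 := Submodule.finrank_quotient_add_finrank (LinearMap.range (pairSum k x y))
  rw [ker_pairSyzygy] at h3
  rw [finrank_prod] at h2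
  omega

lemma mem_smul_top_iff (m J : Ideal R) (a : J) :
    a ∈ (m • ⊤ : Submodule R J) ↔ (a : R) ∈ m * J := by
  have hmap : (m • ⊤ : Submodule R J).map J.subtype = m * J := by
    rw [Submodule.map_smul'', Submodule.map_top, Submodule.range_subtype, smul_eq_mul]
  rw [← hmap]
  constructor
  · exact fun h => ⟨a, h, rfl⟩
  · rintro ⟨b, hb, hab⟩
    rwa [← Subtype.ext hab]

lemma mem_span_pair_mul_iff (x y : R) (J : Ideal R) (a : R) :
    a ∈ Ideal.span {x, y} * J ↔ ∃ u ∈ J, ∃ v ∈ J, a = x * u + y * v := by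
  rw [Ideal.span_insert, Ideal.sup_mul, Submodule.mem_sup]
  simp only [Ideal.mem_span_singleton_mul]
  constructor
  · rintro ⟨_, ⟨u, hu, rfl⟩, _, ⟨v, hv, rfl⟩, rfl⟩
    exact ⟨u, hu, v, hv, rfl⟩
  · rintro ⟨u, hu, v, hv, rfl⟩
    exact ⟨_, ⟨u, hu, rfl⟩, _, ⟨v, hv, rfl⟩, rfl⟩

/-- `dim J / mJ` is one more than the socle dimension of `R / J`: both compute Koszul homology of
`R / J` with respect to the regular sequence `x, y`. -/
theorem finrank_ideal_quotient_eq_finrank_pairSocle_add_one {x y : R} {J : Ideal R}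
    [Module.Finite k (R ⧸ J)]
    (hreg : ∀ a b : R, x * a + y * b = 0 → ∃ c, a = y * c ∧ b = -(x * c))
    (hm : Ideal.span {x, y} ≠ ⊤) (hJ : J ≤ Ideal.span {x, y})
    (hres : ∀ r : R, ∃ c : k, r - algebraMap k R c ∈ Ideal.span {x, y}) :
    finrank k (J ⧸ (Ideal.span {x, y} • ⊤ : Submodule R J)) =
      finrank k (pairSocle k (Ideal.Quotient.mk J x) (Ideal.Quotient.mk J y)) + 1 := by
  set m := Ideal.span {x, y} with hmdef
  set q := Ideal.Quotient.mkₐ k J with hq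
  have hqmem : ∀ r, q r = 0 ↔ r ∈ J := fun r => Ideal.Quotient.eq_zero_iff_mem
  have hqs : Function.Surjective q := Ideal.Quotient.mkₐ_surjective k J
  have hrank : finrank k ((R ⧸ J) ⧸ LinearMap.range (pairSum k (q x) (q y))) = 1 := by
    refine finrank_eq_one (Submodule.Quotient.mk (1 : R ⧸ J)) ?_ ?_
    · rw [Ne, Submodule.Quotient.mk_eq_zero]
      rintro ⟨⟨a, b⟩, hab⟩
      obtain ⟨a, rfl⟩ := hqs a
      obtain ⟨b, rfl⟩ := hqs b
      apply hm
      rw [Ideal.eq_top_iff_one]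
      have : x * a + y * b - 1 ∈ J := by
        rw [← hqmem, map_sub, map_one, sub_eq_zero, ← hab]
        simp
      have h2 : x * a + y * b ∈ m := Ideal.mem_span_pair.2 ⟨a, b, by ring⟩
      simpa using sub_mem h2 (hJ this)
    · intro w
      obtain ⟨w, rfl⟩ := Submodule.Quotient.mk_surjective _ w
      obtain ⟨r, rfl⟩ := hqs w
      obtain ⟨c, hc⟩ := hres r
      obtain ⟨a, b, hab⟩ := Ideal.mem_span_pair.1 hc
      refine ⟨c, ?_⟩
      rw [← Submodule.Quotient.mk_smul, eq_comm, Submodule.Quotient.eq]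
      refine ⟨(q a, q b), ?_⟩
      rw [pairSum_apply, ← map_mul, ← map_mul, ← map_add, ← map_one q, ← map_smul, ← map_sub]
      congr 1
      rw [Algebra.smul_def]
      linear_combination hab
  -- The pairs `(a, b)` with `xa + yb ∈ J` map onto `J/mJ` by `θ` and onto the first Koszul homology
  -- of `R/J` by `ψ`; equality of the two kernels identifies the targets.
  set Z : Submodule k (R × R) := (J.restrictScalars k).comap (pairSum k x y) with hZ
  let θ : Z →ₗ[k] (J ⧸ (m • ⊤ : Submodule R J)) :=
    ((m • ⊤ : Submodule R J).mkQ.restrictScalars k) ∘ₗ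
      ((pairSum k x y).restrict (p := Z) (q := J.restrictScalars k) fun p hp => hp)
  let ψ : Z →ₗ[k] ((R ⧸ J) × (R ⧸ J)) ⧸ LinearMap.range (pairSyzygy k (q x) (q y)) :=
    (LinearMap.range (pairSyzygy k (q x) (q y))).mkQ ∘ₗ
      (q.toLinearMap.prodMap q.toLinearMap) ∘ₗ Z.subtype
  have hθ : Function.Surjective θ := by
    intro j
    obtain ⟨⟨j, hj⟩, rfl⟩ := Submodule.Quotient.mk_surjective _ j
    obtain ⟨a, b, hab⟩ := Ideal.mem_span_pair.1 (hJ hj)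
    have h1 : pairSum k x y (a, b) = j := by rw [pairSum_apply, ← hab]; ring
    refine ⟨⟨(a, b), ?_⟩, ?_⟩
    · change pairSum k x y (a, b) ∈ J
      rwa [h1]
    · change Submodule.Quotient.mk _ = _
      congr 1
      exact Subtype.ext h1
  have hψ : LinearMap.range ψ = (LinearMap.ker (pairSum k (q x) (q y))).map
      (LinearMap.range (pairSyzygy k (q x) (q y))).mkQ := by
    have hZmap : Z.map (q.toLinearMap.prodMap q.toLinearMap) =
        LinearMap.ker (pairSum k (q x) (q y)) := by
      ext ⟨a, b⟩
      obtain ⟨a, rfl⟩ := hqs a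
      obtain ⟨b, rfl⟩ := hqs b
      have hk : (q a, q b) ∈ LinearMap.ker (pairSum k (q x) (q y)) ↔ (a, b) ∈ Z := by
        rw [LinearMap.mem_ker, pairSum_apply, ← map_mul, ← map_mul, ← map_add, hqmem]
        simp [hZ]
      rw [hk]
      constructor
      · rintro ⟨⟨a', b'⟩, hab', he⟩
        have h1 : q a' = q a := congrArg Prod.fst he
        have h2 : q b' = q b := congrArg Prod.snd he
        have h1' : a' - a ∈ J := by rw [← hqmem, map_sub, h1, sub_self]
        have h2' : b' - b ∈ J := by rw [← hqmem, map_sub, h2, sub_self]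
        have h3 : pairSum k x y (a', b') ∈ J := hab'
        change pairSum k x y (a, b) ∈ J
        rw [pairSum_apply] at h3 ⊢
        have := sub_mem h3 (add_mem (J.mul_mem_left x h1') (J.mul_mem_left y h2'))
        convert this using 1
        ring
      · exact fun h => ⟨(a, b), h, rfl⟩
    rw [← hZmap, LinearMap.range_comp, LinearMap.range_comp, Submodule.range_subtype]
  have hker : LinearMap.ker θ = LinearMap.ker ψ := by
    ext ⟨⟨a, b⟩, hab⟩
    have h1 : (⟨(a, b), hab⟩ : Z) ∈ LinearMap.ker θ ↔ x * a + y * b ∈ m * J := by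
      rw [LinearMap.mem_ker]
      change Submodule.Quotient.mk _ = _ ↔ _
      rw [Submodule.Quotient.mk_eq_zero, mem_smul_top_iff]
      change pairSum k x y (a, b) ∈ m * J ↔ _
      rw [pairSum_apply]
    have h2 : (⟨(a, b), hab⟩ : Z) ∈ LinearMap.ker ψ ↔
        ∃ c, q y * q c = q a ∧ -(q x * q c) = q b := by
      rw [LinearMap.mem_ker]
      change Submodule.Quotient.mk _ = _ ↔ _
      rw [Submodule.Quotient.mk_eq_zero]
      constructor
      · rintro ⟨c, hc⟩
        obtain ⟨c, rfl⟩ := hqs c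
        exact ⟨c, congrArg Prod.fst hc, congrArg Prod.snd hc⟩
      · rintro ⟨c, hc, hc'⟩
        exact ⟨q c, Prod.ext hc hc'⟩
    rw [h1, h2, mem_span_pair_mul_iff]
    -- If `xa + yb = xu + yv` with `u, v ∈ J`, regularity makes `(a - u, b - v)` a Koszul syzygy;
    -- conversely, subtracting a lifted Koszul syzygy leaves coefficients in `J`.
    constructor
    · rintro ⟨u, hu, v, hv, huv⟩
      obtain ⟨c, hc, hc'⟩ := hreg (a - u) (b - v) (by linear_combination huv)
      refine ⟨c, ?_, ?_⟩
      · rw [← map_mul, ← hc, map_sub, (hqmem u).2 hu, sub_zero]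
      · rw [← map_mul, ← map_neg, ← hc', map_sub, (hqmem v).2 hv, sub_zero]
    · rintro ⟨c, hc, hc'⟩
      refine ⟨a - y * c, ?_, b + x * c, ?_, by ring⟩
      · rw [← hqmem, map_sub, map_mul, hc, sub_self]
      · rw [← hqmem, map_add, map_mul, ← hc', neg_add_cancel]
  have e1 := (θ.quotKerEquivOfSurjective hθ).finrank_eq
  rw [hker, (ψ.quotKerEquivRange).finrank_eq, hψ, finrank_map_mkQ_ker_pairSum _ _ hrank] at e1
  exact e1.symm

end Koszul

end PowerSeriesIdeal

namespace PowerSeriesIdeal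

open Module MvPowerSeries

/-! ### Coefficients and powers of the maximal ideal in `k[[x, y]]` -/

section PowerSeries

variable {k : Type*} [Field k]

/-- The exponent of the monomial `x ^ a * y ^ b`. -/
noncomputable def bidegree (a b : ℕ) : Fin 2 →₀ ℕ := Finsupp.single 0 a + Finsupp.single 1 b

@[simp] lemma bidegree_zero (a b : ℕ) : bidegree a b 0 = a := by simp [bidegree]

@[simp] lemma bidegree_one (a b : ℕ) : bidegree a b 1 = b := by simp [bidegree]

lemma eq_bidegree (d : Fin 2 →₀ ℕ) : d = bidegree (d 0) (d 1) := by
  ext i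
  fin_cases i <;> simp

lemma bidegree_inj {a b a' b' : ℕ} : bidegree a b = bidegree a' b' ↔ a = a' ∧ b = b' := by
  constructor
  · intro h
    exact ⟨by simpa using DFunLike.congr_fun h 0, by simpa using DFunLike.congr_fun h 1⟩
  · rintro ⟨rfl, rfl⟩
    rfl

lemma degree_bidegree (a b : ℕ) : (bidegree a b).degree = a + b := by
  simp [Finsupp.degree_eq_sum, Fin.sum_univ_two]

lemma X_pow_mul_X_pow (a b : ℕ) :
    (X 0 ^ a * X 1 ^ b : R k) = monomial (bidegree a b) 1 := by
  rw [X_pow_eq, X_pow_eq, monomial_mul_monomial, one_mul, bidegree]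

lemma coeff_bidegree_X_zero_mul (a b : ℕ) (f : R k) :
    coeff (bidegree (a + 1) b) (X 0 * f) = coeff (bidegree a b) f := by
  have : bidegree (a + 1) b = Finsupp.single 0 1 + bidegree a b := by
    ext i; fin_cases i <;> simp [bidegree, add_comm]
  rw [this, X_def, coeff_add_monomial_mul, one_mul]

lemma coeff_bidegree_X_one_mul (a b : ℕ) (f : R k) :
    coeff (bidegree a (b + 1)) (X 1 * f) = coeff (bidegree a b) f := by
  have : bidegree a (b + 1) = Finsupp.single 1 1 + bidegree a b := by
    ext i; fin_cases i <;> simp [bidegree, add_comm]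
  rw [this, X_def, coeff_add_monomial_mul, one_mul]

lemma coeff_bidegree_zero_X_zero_mul (b : ℕ) (f : R k) :
    coeff (bidegree 0 b) (X 0 * f) = 0 :=
  X_dvd_iff.1 (dvd_mul_right _ f) _ (by simp)

lemma coeff_bidegree_X_one_mul_zero (a : ℕ) (f : R k) :
    coeff (bidegree a 0) (X 1 * f) = 0 :=
  X_dvd_iff.1 (dvd_mul_right _ f) _ (by simp)

lemma ext_bidegree {f g : R k} (h : ∀ a b, coeff (bidegree a b) f = coeff (bidegree a b) g) :
    f = g := by
  ext d
  rw [eq_bidegree d]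
  exact h _ _

lemma exists_coeff_bidegree (c : ℕ → ℕ → k) : ∃ f : R k, ∀ a b, coeff (bidegree a b) f = c a b := by
  refine ⟨(fun d => c (d 0) (d 1) : (Fin 2 →₀ ℕ) → k), fun a b => ?_⟩
  change c (bidegree a b 0) (bidegree a b 1) = _
  rw [bidegree_zero, bidegree_one]

/-- Terms divisible by `x` go to `g`, pure powers of `y` to `g'`. The explicit coefficients show
that orders drop by at most one, as the induction in `mem_maximalIdeal_pow_iff` needs. -/
lemma exists_eq_X_mul_add_X_mul {f : R k} (hf : coeff (bidegree 0 0) f = 0) :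
    ∃ g g' : R k, f = X 0 * g + X 1 * g' ∧
      (∀ a b, coeff (bidegree a b) g = coeff (bidegree (a + 1) b) f) ∧
      (∀ a b, coeff (bidegree a b) g' = if a = 0 then coeff (bidegree 0 (b + 1)) f else 0) := by
  obtain ⟨g, hg⟩ := exists_coeff_bidegree fun a b => coeff (bidegree (a + 1) b) f
  obtain ⟨g', hg'⟩ := exists_coeff_bidegree fun a b =>
    if a = 0 then coeff (bidegree 0 (b + 1)) f else 0
  refine ⟨g, g', ext_bidegree fun a b => ?_, hg, hg'⟩
  rw [map_add]
  rcases a with _ | a <;> rcases b with _ | b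
  · rw [coeff_bidegree_zero_X_zero_mul, coeff_bidegree_X_one_mul_zero, hf, add_zero]
  · rw [coeff_bidegree_zero_X_zero_mul, coeff_bidegree_X_one_mul, hg', if_pos rfl, zero_add]
  · rw [coeff_bidegree_X_zero_mul, coeff_bidegree_X_one_mul_zero, hg, add_zero]
  · rw [coeff_bidegree_X_zero_mul, coeff_bidegree_X_one_mul, hg, hg', if_neg (by omega), add_zero]

lemma mem_maximalIdeal_iff (f : R k) :
    f ∈ IsLocalRing.maximalIdeal (R k) ↔ coeff (bidegree 0 0) f = 0 := by
  have : (bidegree 0 0) = 0 := by simp [bidegree]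
  rw [IsLocalRing.mem_maximalIdeal, mem_nonunits_iff, MvPowerSeries.isUnit_iff_constantCoeff,
    isUnit_iff_ne_zero, not_not, this, coeff_zero_eq_constantCoeff_apply]

lemma maximalIdeal_eq_span : IsLocalRing.maximalIdeal (R k) = Ideal.span {X 0, X 1} := by
  apply le_antisymm
  · intro f hf
    obtain ⟨g, g', h, -⟩ := exists_eq_X_mul_add_X_mul ((mem_maximalIdeal_iff f).1 hf)
    exact Ideal.mem_span_pair.2 ⟨g, g', by rw [h]; ring⟩
  · rw [Ideal.span_le]
    rintro _ (rfl | rfl)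
    · exact (mem_maximalIdeal_iff _).2 (by simpa using coeff_bidegree_zero_X_zero_mul 0 (1 : R k))
    · exact (mem_maximalIdeal_iff _).2 (by simpa using coeff_bidegree_X_one_mul_zero 0 (1 : R k))

lemma mem_maximalIdeal_pow_iff (i : ℕ) (f : R k) :
    f ∈ IsLocalRing.maximalIdeal (R k) ^ i ↔
      ∀ a b, a + b < i → coeff (bidegree a b) f = 0 := by
  induction i generalizing f with
  | zero => simp
  | succ i ih =>
    rw [pow_succ', maximalIdeal_eq_span, mem_span_pair_mul_iff, ← maximalIdeal_eq_span]
    constructor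
    · rintro ⟨u, hu, v, hv, rfl⟩ a b hab
      rw [ih] at hu hv
      rw [map_add]
      rcases a with _ | a <;> rcases b with _ | b
      · rw [coeff_bidegree_zero_X_zero_mul, coeff_bidegree_X_one_mul_zero, add_zero]
      · rw [coeff_bidegree_zero_X_zero_mul, coeff_bidegree_X_one_mul, hv _ _ (by omega), add_zero]
      · rw [coeff_bidegree_X_zero_mul, coeff_bidegree_X_one_mul_zero, hu _ _ (by omega), add_zero]
      · rw [coeff_bidegree_X_zero_mul, coeff_bidegree_X_one_mul, hu _ _ (by omega),
          hv _ _ (by omega), add_zero]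
    · intro hf
      obtain ⟨g, g', h, hg, hg'⟩ := exists_eq_X_mul_add_X_mul (hf 0 0 (by omega))
      refine ⟨g, (ih g).2 fun a b hab => ?_, g', (ih g').2 fun a b hab => ?_, h⟩
      · rw [hg, hf _ _ (by omega)]
      · rw [hg']
        split_ifs with ha
        · exact hf _ _ (by omega)
        · rfl

lemma exists_sub_algebraMap_mem (f : R k) :
    ∃ c : k, f - algebraMap k (R k) c ∈ Ideal.span {(X 0 : R k), X 1} := by
  refine ⟨coeff (bidegree 0 0) f, ?_⟩
  rw [← maximalIdeal_eq_span, mem_maximalIdeal_iff, map_sub, sub_eq_zero]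
  have : (bidegree 0 0) = 0 := by simp [bidegree]
  rw [this, MvPowerSeries.algebraMap_apply, coeff_zero_C]
  rfl

lemma exists_eq_of_X_mul_add_X_mul_eq_zero {f g : R k} (h : X 0 * f + X 1 * g = 0) :
    ∃ c, f = X 1 * c ∧ g = -(X 0 * c) := by
  have hX : (X 1 : R k) ≠ 0 := by
    intro h0
    have := congrArg (coeff (Finsupp.single 1 1)) h0
    rw [coeff_index_single_self_X, map_zero] at this
    exact one_ne_zero this
  have hdvd : (X 1 : R k) ∣ f := by
    refine X_dvd_iff.2 fun d hd => ?_
    rw [eq_bidegree d, hd, ← coeff_bidegree_X_zero_mul]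
    have := congrArg (coeff (bidegree (d 0 + 1) 0)) h
    rwa [map_add, coeff_bidegree_X_one_mul_zero, add_zero, LinearMap.map_zero] at this
  obtain ⟨c, rfl⟩ := hdvd
  refine ⟨c, rfl, mul_left_cancel₀ hX ?_⟩
  linear_combination h

lemma finrank_quotient_maximalIdeal :
    finrank k (R k ⧸ IsLocalRing.maximalIdeal (R k)) = 1 := by
  refine finrank_eq_one (1 : R k ⧸ IsLocalRing.maximalIdeal (R k)) one_ne_zero fun w => ?_
  obtain ⟨r, rfl⟩ := Ideal.Quotient.mk_surjective w
  obtain ⟨c, hc⟩ := exists_sub_algebraMap_mem r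
  rw [← maximalIdeal_eq_span] at hc
  refine ⟨c, ?_⟩
  rw [Algebra.smul_def, mul_one, eq_comm]
  exact (Ideal.Quotient.eq).2 hc

/-- Nakayama gives the dimension over the residue field, and the residue field is one-dimensional
over `k`. -/
lemma minGenerators_eq_finrank (J : Ideal (R k)) :
    minGenerators J =
      finrank k (J ⧸ (IsLocalRing.maximalIdeal (R k) • ⊤ : Submodule (R k) J)) := by
  rw [minGenerators, IsLocalRing.spanFinrank_eq_finrank_quotient J (IsNoetherian.noetherian J)]
  set m := IsLocalRing.maximalIdeal (R k)
  have : Module.Free (R k ⧸ m) (J ⧸ (m • ⊤ : Submodule (R k) J)) := by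
    let := Ideal.Quotient.field m
    infer_instance
  have : Module.Free k (R k ⧸ m) := inferInstance
  have : IsScalarTower k (R k ⧸ m) (J ⧸ (m • ⊤ : Submodule (R k) J)) := by
    refine ⟨fun c r v => ?_⟩
    obtain ⟨r, rfl⟩ := Ideal.Quotient.mk_surjective r
    obtain ⟨v, rfl⟩ := Submodule.Quotient.mk_surjective _ v
    change Submodule.Quotient.mk ((c • r) • v) = Submodule.Quotient.mk (c • (r • v))
    rw [smul_assoc]
  rw [← finrank_mul_finrank k (R k ⧸ m), finrank_quotient_maximalIdeal, one_mul]

theorem minGenerators_eq_finrank_pairSocle_add_one {J : Ideal (R k)} (hJ : IsZeroDimensional J) :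
    minGenerators J = finrank k
      (pairSocle k (Ideal.Quotient.mk J (X 0)) (Ideal.Quotient.mk J (X 1))) + 1 := by
  have := hJ.2
  rw [minGenerators_eq_finrank, maximalIdeal_eq_span]
  refine finrank_ideal_quotient_eq_finrank_pairSocle_add_one
    (fun _ _ => exists_eq_of_X_mul_add_X_mul_eq_zero) ?_ ?_ exists_sub_algebraMap_mem
  · rw [← maximalIdeal_eq_span]
    exact Ideal.IsPrime.ne_top'
  · rw [← maximalIdeal_eq_span]
    exact IsLocalRing.le_maximalIdeal hJ.1

end PowerSeries

end PowerSeriesIdeal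

namespace PowerSeriesIdeal

open Module MvPowerSeries

/-! ### The Hilbert function and order of a zero-dimensional ideal -/

section HilbertFunction

variable {k : Type*} [Field k] {J : Ideal (R k)}

lemma maxIdealQuot_eq_span (J : Ideal (R k)) : maxIdealQuot J =
    Ideal.span {Ideal.Quotient.mk J (X 0), Ideal.Quotient.mk J (X 1)} := by
  rw [maxIdealQuot, maximalIdeal_eq_span, Ideal.map_span, Set.image_pair]

lemma exists_sub_algebraMap_mem_maxIdealQuot (a : R k ⧸ J) :
    ∃ c : k, a - algebraMap k (R k ⧸ J) c ∈ maxIdealQuot J := by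
  obtain ⟨f, rfl⟩ := Ideal.Quotient.mk_surjective a
  obtain ⟨c, hc⟩ := exists_sub_algebraMap_mem f
  rw [← maximalIdeal_eq_span] at hc
  exact ⟨c, Ideal.mem_map_of_mem _ hc⟩

lemma mem_maxIdealQuot_pow_iff (i : ℕ) (a : R k ⧸ J) : a ∈ maxIdealQuot J ^ i ↔
    ∃ f ∈ IsLocalRing.maximalIdeal (R k) ^ i, Ideal.Quotient.mk J f = a := by
  rw [maxIdealQuot, ← Ideal.map_pow,
    Ideal.mem_map_iff_of_surjective _ Ideal.Quotient.mk_surjective]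

lemma mk_mem_maxIdealQuot_pow {i : ℕ} {f : R k}
    (hf : f ∈ IsLocalRing.maximalIdeal (R k) ^ i) :
    Ideal.Quotient.mk J f ∈ maxIdealQuot J ^ i :=
  (mem_maxIdealQuot_pow_iff i _).2 ⟨f, hf, rfl⟩

lemma maxIdealQuot_ne_top (hJ : J ≠ ⊤) : maxIdealQuot J ≠ ⊤ := by
  intro h
  have h1 : (1 : R k ⧸ J) ∈ maxIdealQuot J ^ 1 := by rw [h, Ideal.top_pow]; trivial
  obtain ⟨f, hf, hf1⟩ := (mem_maxIdealQuot_pow_iff 1 1).1 h1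
  rw [pow_one] at hf
  have h2 : f - 1 ∈ J := (Ideal.Quotient.eq).1 (by rw [hf1, map_one])
  have h3 := sub_mem hf (IsLocalRing.le_maximalIdeal hJ h2)
  rw [sub_sub_cancel] at h3
  exact Ideal.IsPrime.ne_top' ((Ideal.eq_top_iff_one _).2 h3)

lemma maxIdealQuot_le_jacobson (hJ : J ≠ ⊤) :
    maxIdealQuot J ≤ Ideal.jacobson (⊥ : Ideal (R k ⧸ J)) := by
  have : Nontrivial (R k ⧸ J) := Ideal.Quotient.nontrivial_iff.2 hJ
  have : IsLocalRing (R k ⧸ J) :=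
    IsLocalRing.of_surjective' (Ideal.Quotient.mk J) Ideal.Quotient.mk_surjective
  rw [IsLocalRing.jacobson_eq_maximalIdeal _ bot_ne_top]
  exact IsLocalRing.le_maximalIdeal (maxIdealQuot_ne_top hJ)

lemma exists_maxIdealQuot_pow_eq_bot (hJ : IsZeroDimensional J) :
    ∃ N, maxIdealQuot J ^ N = ⊥ := by
  have := hJ.2
  have : IsArtinianRing (R k ⧸ J) := IsArtinianRing.of_finite k _
  obtain ⟨N, hN⟩ := IsArtinianRing.isNilpotent_jacobson_bot (R := R k ⧸ J)
  refine ⟨N, eq_bot_iff.2 ?_⟩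
  rw [← Ideal.zero_eq_bot, ← hN]
  exact Ideal.pow_right_mono (maxIdealQuot_le_jacobson hJ.1) N

lemma hilbertFunction_add_finrank [Module.Finite k (R k ⧸ J)] (i : ℕ) :
    hilbertFunction J i + finrank k ↥(maxIdealQuot J ^ (i + 1)) =
      finrank k ↥(maxIdealQuot J ^ i) :=
  finrank_pow_quotient_add _ i

lemma exists_hilbertFunction_eq_zero (hJ : IsZeroDimensional J) :
    ∃ s, ∀ i > s, hilbertFunction J i = 0 := by
  have := hJ.2
  obtain ⟨N, hN⟩ := exists_maxIdealQuot_pow_eq_bot hJ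
  refine ⟨N, fun i hi => ?_⟩
  have h := hilbertFunction_add_finrank (J := J) i
  have h0 : maxIdealQuot J ^ i = ⊥ :=
    eq_bot_iff.2 (hN ▸ Ideal.pow_le_pow_right hi.le)
  have : finrank k ↥(maxIdealQuot J ^ i) = 0 := by
    rw [h0]
    exact finrank_bot k (R k ⧸ J)
  omega

/-- The infimum is attained once its set is nonempty, and nilpotency of the maximal ideal of `R/J`
puts a power of `x` in `J`. -/
lemma exists_mem_order_eq_idealOrder (hJ : IsZeroDimensional J) :
    ∃ f ∈ J, order f = (idealOrder J : ℕ∞) := by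
  obtain ⟨N, hN⟩ := exists_maxIdealQuot_pow_eq_bot hJ
  have hmem : (X 0 ^ N : R k) ∈ J := by
    rw [← Ideal.Quotient.eq_zero_iff_mem, ← Ideal.mem_bot, ← hN]
    refine mk_mem_maxIdealQuot_pow (Ideal.pow_mem_pow ?_ N)
    rw [maximalIdeal_eq_span]
    exact Ideal.subset_span (by simp)
  refine Nat.sInf_mem (s := {n : ℕ | ∃ f ∈ J, MvPowerSeries.order f = (n : ℕ∞)})
    ⟨N, X 0 ^ N, hmem, ?_⟩
  rw [X_pow_eq, order_monomial_of_ne_zero one_ne_zero, Finsupp.degree_single]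

lemma le_maximalIdeal_pow_idealOrder (J : Ideal (R k)) :
    J ≤ IsLocalRing.maximalIdeal (R k) ^ idealOrder J := by
  intro f hf
  rw [mem_maximalIdeal_pow_iff]
  intro a b hab
  by_cases h0 : f = 0
  · rw [h0, LinearMap.map_zero]
  have h1 : idealOrder J ≤ f.order.toNat :=
    Nat.sInf_le ⟨f, hf, (ne_zero_iff_order_finite.1 h0).symm⟩
  refine coeff_of_lt_order ?_
  rw [← ne_zero_iff_order_finite.1 h0, degree_bidegree]
  exact_mod_cast hab.trans_le h1

lemma idealOrder_pos (hJ : IsZeroDimensional J) : 1 ≤ idealOrder J := by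
  obtain ⟨f, hf, hord⟩ := exists_mem_order_eq_idealOrder hJ
  by_contra h
  have h0 : idealOrder J = 0 := by omega
  rw [h0, Nat.cast_zero] at hord
  exact order_ne_zero_iff_constCoeff_eq_zero.2
    (by
      have := (mem_maximalIdeal_iff f).1 (IsLocalRing.le_maximalIdeal hJ.1 hf)
      have h00 : (bidegree 0 0) = 0 := by simp [bidegree]
      rwa [h00, coeff_zero_eq_constantCoeff_apply] at this) hord

/-- Below degree `t` the ideal imposes no relation: the `i + 1` coefficients of degree `i` descend
to `R/J`, and on `n^i` their common kernel is `n^(i+1)`. -/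
lemma hilbertFunction_of_lt [Module.Finite k (R k ⧸ J)] {t : ℕ}
    (hJ : J ≤ IsLocalRing.maximalIdeal (R k) ^ t) {i : ℕ} (hi : i < t) :
    hilbertFunction J i = i + 1 := by
  let L : R k →ₗ[k] (Fin (i + 1) → k) := LinearMap.pi fun j => coeff (bidegree j (i - j))
  have hL : ∀ f ∈ IsLocalRing.maximalIdeal (R k) ^ i, L f = 0 →
      f ∈ IsLocalRing.maximalIdeal (R k) ^ (i + 1) := by
    intro f hf h0
    rw [mem_maximalIdeal_pow_iff] at hf ⊢
    intro a b hab
    by_cases h : a + b < i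
    · exact hf a b h
    · obtain rfl : b = i - a := by omega
      exact congrFun h0 ⟨a, by omega⟩
  have hL' : ∀ f ∈ IsLocalRing.maximalIdeal (R k) ^ (i + 1), L f = 0 := by
    intro f hf
    rw [mem_maximalIdeal_pow_iff] at hf
    ext j
    exact hf _ _ (by omega)
  have hJL : J.restrictScalars k ≤ LinearMap.ker L :=
    fun f hf => hL' f (Ideal.pow_le_pow_right hi (hJ hf))
  let L' : (R k ⧸ J) →ₗ[k] (Fin (i + 1) → k) :=
    (Submodule.liftQ (J.restrictScalars k) L hJL) ∘ₗ
      (Submodule.Quotient.restrictScalarsEquiv k J).symm.toLinearMap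
  have hmk : ∀ f, L' (Ideal.Quotient.mk J f) = L f := fun f => rfl
  have h1 := finrank_map_add_finrank_inf_ker L' ((maxIdealQuot J ^ i).restrictScalars k)
  have h2 : ((maxIdealQuot J ^ i).restrictScalars k).map L' = ⊤ := by
    rw [eq_top_iff]
    intro v _
    refine ⟨Ideal.Quotient.mk J
      (∑ j : Fin (i + 1), v j • monomial (bidegree j (i - j)) (1 : k)), ?_, ?_⟩
    · refine mk_mem_maxIdealQuot_pow (sum_mem fun j _ => ?_)
      rw [mem_maximalIdeal_pow_iff]
      intro a b hab
      rw [LinearMap.map_smul, coeff_monomial_ne, smul_zero]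
      rw [Ne, bidegree_inj]
      omega
    · rw [hmk, map_sum]
      ext j
      rw [Finset.sum_apply, Finset.sum_eq_single j]
      · change coeff (bidegree j (i - j)) (v j • monomial (bidegree j (i - j)) (1 : k)) = v j
        rw [LinearMap.map_smul, coeff_monomial_same, smul_eq_mul, mul_one]
      · intro l _ hl
        change coeff (bidegree j (i - j)) (v l • monomial (bidegree l (i - l)) (1 : k)) = 0
        rw [LinearMap.map_smul, coeff_monomial_ne, smul_zero]
        rw [Ne, bidegree_inj]
        exact fun h => hl (Fin.ext h.1.symm)
      · simp
  have h3 : (maxIdealQuot J ^ i).restrictScalars k ⊓ LinearMap.ker L' =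
      (maxIdealQuot J ^ (i + 1)).restrictScalars k := by
    ext a
    constructor
    · rintro ⟨ha, ha'⟩
      obtain ⟨f, hf, rfl⟩ := (mem_maxIdealQuot_pow_iff i a).1 ha
      exact mk_mem_maxIdealQuot_pow (hL f hf ha')
    · intro ha
      obtain ⟨f, hf, rfl⟩ := (mem_maxIdealQuot_pow_iff (i + 1) a).1 ha
      exact ⟨Ideal.pow_le_pow_right (Nat.le_add_right i 1) ha, hL' f hf⟩
  rw [h2, h3, finrank_top, finrank_fintype_fun_eq_card, Fintype.card_fin] at h1
  have h4 := hilbertFunction_add_finrank (J := J) i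
  have h5 : finrank k ↥((maxIdealQuot J ^ (i + 1)).restrictScalars k) =
    finrank k ↥(maxIdealQuot J ^ (i + 1)) := rfl
  have h6 : finrank k ↥((maxIdealQuot J ^ i).restrictScalars k) =
    finrank k ↥(maxIdealQuot J ^ i) := rfl
  omega

end HilbertFunction

/-! ### A general linear form and the bounds -/

section GeneralLinearForm

lemma span_pair_pow_succ_le {A : Type*} [CommRing A] (z w : A) (i : ℕ) :
    Ideal.span {z, w} ^ (i + 1) ≤
      Ideal.span {z} * Ideal.span {z, w} ^ i ⊔ Ideal.span {w ^ (i + 1)} := by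
  induction i with
  | zero => simp [Ideal.span_insert]
  | succ i ih =>
    have h1 : Ideal.span {z, w} ^ (i + 1 + 1) =
        Ideal.span {z} * Ideal.span {z, w} ^ (i + 1) ⊔
          Ideal.span {w} * Ideal.span {z, w} ^ (i + 1) := by
      rw [pow_succ' _ (i + 1), ← Ideal.sup_mul, ← Ideal.span_insert]
    rw [h1]
    refine sup_le le_sup_left ?_
    calc Ideal.span {w} * Ideal.span {z, w} ^ (i + 1)
        ≤ Ideal.span {w} * (Ideal.span {z} * Ideal.span {z, w} ^ i ⊔ Ideal.span {w ^ (i + 1)}) :=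
          Ideal.mul_mono_right ih
      _ = Ideal.span {z} * (Ideal.span {w} * Ideal.span {z, w} ^ i) ⊔
          Ideal.span {w ^ (i + 1 + 1)} := by
          rw [Ideal.mul_sup, Ideal.span_singleton_mul_span_singleton, ← pow_succ', ← mul_assoc,
            ← mul_assoc, mul_comm (Ideal.span {w})]
      _ ≤ _ := by
          refine sup_le_sup_right (Ideal.mul_mono_right ?_) _
          rw [pow_succ']
          exact Ideal.mul_mono_left (Ideal.span_mono (by simp))

/-- Modulo `z` one has `x ≡ cw`; replacing the factors `x` one at a time keeps each error in `z
n^s`. -/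
lemma pow_mul_pow_sub_mem {A : Type*} [CommRing A] {n : Ideal A} {x z w c : A} (hz : z ∈ n)
    (hw : w ∈ n) (hx : x = z + c * w) (s a b : ℕ) (hab : a + b = s + 1) :
    x ^ a * w ^ b - c ^ a * w ^ (s + 1) ∈ Ideal.span {z} * n ^ s := by
  have hxn : x ∈ n := hx ▸ add_mem hz (n.mul_mem_left c hw)
  induction a generalizing b with
  | zero =>
    obtain rfl : b = s + 1 := by omega
    simp
  | succ a ih =>
    have h1 := ih (b + 1) (by omega)
    have h2 : z * (x ^ a * w ^ b) ∈ Ideal.span {z} * n ^ s := by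
      refine Ideal.mul_mem_mul (Ideal.mem_span_singleton_self z) ?_
      obtain rfl : s = a + b := by omega
      rw [pow_add]
      exact Ideal.mul_mem_mul (Ideal.pow_mem_pow hxn a) (Ideal.pow_mem_pow hw b)
    have h3 := add_mem h2 (Ideal.mul_mem_left _ c h1)
    convert h3 using 1
    rw [pow_succ x a]
    linear_combination x ^ a * w ^ b * hx

variable {k : Type*} [Field k] {J : Ideal (R k)}

lemma sub_sum_mem_maximalIdeal_pow {t : ℕ} {f : R k}
    (hf : f ∈ IsLocalRing.maximalIdeal (R k) ^ t) :
    f - ∑ j ∈ Finset.range (t + 1), coeff (bidegree j (t - j)) f • (X 0 ^ j * X 1 ^ (t - j)) ∈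
      IsLocalRing.maximalIdeal (R k) ^ (t + 1) := by
  rw [mem_maximalIdeal_pow_iff] at hf ⊢
  intro a b hab
  rw [map_sub, map_sum, sub_eq_zero]
  by_cases h : a + b < t
  · rw [hf a b h, Finset.sum_eq_zero]
    intro j hj
    rw [LinearMap.map_smul, X_pow_mul_X_pow, coeff_monomial_ne, smul_zero]
    rw [Ne, bidegree_inj]
    rw [Finset.mem_range] at hj
    omega
  · obtain rfl : b = t - a := by omega
    rw [Finset.sum_eq_single a]
    · rw [LinearMap.map_smul, X_pow_mul_X_pow, coeff_monomial_same, smul_eq_mul, mul_one]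
    · intro j _ hj
      rw [LinearMap.map_smul, X_pow_mul_X_pow, coeff_monomial_ne, smul_zero]
      rw [Ne, bidegree_inj]
      omega
    · intro h'
      rw [Finset.mem_range] at h'
      omega

/-- Multiplication by a general linear form is surjective from degree `ord J - 1` on. -/
theorem exists_linearForm [Infinite k] (hJ : IsZeroDimensional J) {s : ℕ}
    (hs : idealOrder J = s + 1) : ∃ c : k, ∃ z : R k ⧸ J,
      z = Ideal.Quotient.mk J (X 0) - algebraMap k _ c * Ideal.Quotient.mk J (X 1) ∧
      maxIdealQuot J ^ (s + 1) ≤ Ideal.span {z} * maxIdealQuot J ^ s := by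
  have := hJ.2
  obtain ⟨f, hfJ, hford⟩ := exists_mem_order_eq_idealOrder hJ
  have hfm := le_maximalIdeal_pow_idealOrder J hfJ
  rw [hs] at hford hfm
  -- The initial form of `f` dehomogenised at `y = 1`. A `c` with `p(c) ≠ 0` means that `x - cy`
  -- does not divide this form.
  let p : Polynomial k := ∑ j ∈ Finset.range (s + 1 + 1),
    Polynomial.monomial j (coeff (bidegree j (s + 1 - j)) f)
  have hp : p ≠ 0 := by
    obtain ⟨d, hd, hdeg⟩ := exists_coeff_ne_zero_and_order (f := f) (by rw [hford]; rfl)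
    rw [hford] at hdeg
    rw [eq_bidegree d, degree_bidegree] at hdeg
    have hdeg' : d 0 + d 1 = s + 1 := by exact_mod_cast hdeg
    intro h0
    have h1 := congrArg (fun q => Polynomial.coeff q (d 0)) h0
    simp only [p, Polynomial.finsetSum_coeff, Polynomial.coeff_monomial,
      Polynomial.coeff_zero] at h1
    rw [Finset.sum_ite_eq' (Finset.range (s + 1 + 1)) (d 0)
      (fun j => coeff (bidegree j (s + 1 - j)) f),
      if_pos (Finset.mem_range.2 (by omega)), show s + 1 - d 0 = d 1 by omega, ← eq_bidegree] at h1
    exact hd h1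
  obtain ⟨c, hc⟩ : ∃ c, p.eval c ≠ 0 := by
    by_contra! h
    exact hp (Polynomial.funext fun c => by rw [h c, Polynomial.eval_zero])
  set q := Ideal.Quotient.mkₐ k J
  set x := q (X 0) with hx
  set w := q (X 1) with hw
  set n := maxIdealQuot J with hn
  set z := x - algebraMap k _ c * w with hz
  have hxn : x ∈ n := by
    rw [hn, maxIdealQuot_eq_span]; exact Ideal.subset_span (by simp [hx, q])
  have hwn : w ∈ n := by
    rw [hn, maxIdealQuot_eq_span]; exact Ideal.subset_span (by simp [hw, q])
  have hzn : z ∈ n := sub_mem hxn (n.mul_mem_left _ hwn)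
  have hspan : n = Ideal.span {z, w} := by
    apply le_antisymm
    · rw [hn, maxIdealQuot_eq_span, Ideal.span_le]
      rintro _ (rfl | rfl)
      · exact Ideal.mem_span_pair.2 ⟨1, algebraMap k _ c, by
          change _ = x
          rw [hz]; ring⟩
      · exact Ideal.subset_span (by simp [hw, q])
    · rw [Ideal.span_le]
      rintro _ (rfl | rfl)
      exacts [hzn, hwn]
  refine ⟨c, z, rfl, ?_⟩
  -- Since `f` vanishes in `R/J`, its initial form lies in `n^(s+2)` there; modulo `z n^s` that form
  -- is `p(c) w^(s+1)`.
  have hsum : (algebraMap k (R k ⧸ J) (p.eval c)) * w ^ (s + 1) ∈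
      Ideal.span {z} * n ^ s ⊔ n ^ (s + 1 + 1) := by
    have h1 : q (f - ∑ j ∈ Finset.range (s + 1 + 1),
        coeff (bidegree j (s + 1 - j)) f • (X 0 ^ j * X 1 ^ (s + 1 - j))) ∈ n ^ (s + 1 + 1) :=
      mk_mem_maxIdealQuot_pow (sub_sum_mem_maximalIdeal_pow hfm)
    have hqf : q f = 0 := Ideal.Quotient.eq_zero_iff_mem.2 hfJ
    rw [map_sub, hqf, zero_sub, neg_mem_iff, map_sum] at h1
    have h2 : ∑ j ∈ Finset.range (s + 1 + 1), algebraMap k (R k ⧸ J) (coeff (bidegree j (s + 1 - j)) f) *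
        (x ^ j * w ^ (s + 1 - j) - algebraMap k _ c ^ j * w ^ (s + 1)) ∈
        Ideal.span {z} * n ^ s := by
      refine sum_mem fun j hj => ?_
      refine Ideal.mul_mem_left _ _ (pow_mul_pow_sub_mem hzn hwn (by rw [hz]; ring) s j _ ?_)
      have := Finset.mem_range.1 hj
      omega
    have h3 := sub_mem
      ((le_sup_right : n ^ (s + 1 + 1) ≤ Ideal.span {z} * n ^ s ⊔ n ^ (s + 1 + 1)) h1)
      ((le_sup_left : Ideal.span {z} * n ^ s ≤ Ideal.span {z} * n ^ s ⊔ n ^ (s + 1 + 1)) h2)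
    convert h3 using 1
    rw [← Finset.sum_sub_distrib, Polynomial.eval_finsetSum, map_sum, Finset.sum_mul]
    refine Finset.sum_congr rfl fun j _ => ?_
    have hsmul : ∀ (a : k) (u : R k), q (a • u) = algebraMap k _ a * q u := fun a u => by
      rw [map_smul]
      exact Algebra.smul_def a (q u)
    rw [Polynomial.eval_monomial, map_mul, map_pow, hsmul, map_mul, map_pow, map_pow]
    ring
  have hwmem : w ^ (s + 1) ∈ Ideal.span {z} * n ^ s ⊔ n ^ (s + 1 + 1) := by
    have := Ideal.mul_mem_left _ (algebraMap k (R k ⧸ J) (p.eval c)⁻¹) hsum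
    rwa [← mul_assoc, ← map_mul, inv_mul_cancel₀ hc, map_one, one_mul] at this
  -- By Nakayama it suffices that `n^(s+1) ⊆ z n^s + n · n^(s+1)`, and modulo `z n^s` only `w^(s+1)`
  -- has to be treated.
  refine Submodule.le_of_le_smul_of_le_jacobson_bot
    (IsNoetherian.noetherian _) (maxIdealQuot_le_jacobson hJ.1) ?_
  rw [smul_eq_mul, ← pow_succ']
  have h4 := span_pair_pow_succ_le z w s
  rw [← hspan] at h4
  exact h4.trans (sup_le le_sup_left ((Ideal.span_singleton_le_iff_mem _).2 hwmem))

lemma pairSocle_sub_mul {A : Type*} [CommRing A] [Algebra k A] (x y c : A) :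
    pairSocle k (x - c * y) y = pairSocle k x y := by
  ext a
  simp only [pairSocle, Submodule.mem_inf, LinearMap.mem_ker, LinearMap.mulLeft_apply]
  refine and_congr_left fun h => ?_
  rw [sub_mul, mul_assoc, h, mul_zero, sub_zero]

theorem isAdmissible_and_bounds [Infinite k] (hJ : IsZeroDimensional J) :
    IsAdmissible (hilbertFunction J) (idealOrder J) ∧
      maxJump (hilbertFunction J) < minGenerators J ∧ minGenerators J ≤ idealOrder J + 1 := by
  have := hJ.2
  have ht := idealOrder_pos hJ
  obtain ⟨s, hs⟩ : ∃ s, idealOrder J = s + 1 := ⟨idealOrder J - 1, by omega⟩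
  obtain ⟨c, z, hz, hle⟩ := exists_linearForm hJ hs
  set x := Ideal.Quotient.mk J (X 0) with hx
  set w := Ideal.Quotient.mk J (X 1) with hw
  set n := maxIdealQuot J with hn
  have hxn : x ∈ n := by
    rw [hn, maxIdealQuot_eq_span]; exact Ideal.subset_span (by simp [hx])
  have hwn : w ∈ n := by
    rw [hn, maxIdealQuot_eq_span]; exact Ideal.subset_span (by simp [hw])
  have hzn : z ∈ n := hz ▸ sub_mem hxn (n.mul_mem_left _ hwn)
  have hspan : n = Ideal.span {z, w} := by
    apply le_antisymm
    · rw [hn, maxIdealQuot_eq_span, Ideal.span_le]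
      rintro _ (rfl | rfl)
      · exact Ideal.mem_span_pair.2 ⟨1, algebraMap k _ c, by rw [hz]; ring⟩
      · exact Ideal.subset_span (by simp [hw])
    · rw [Ideal.span_le]
      rintro _ (rfl | rfl)
      exacts [hzn, hwn]
  have hsoc : finrank k (pairSocle k z w) + 1 = minGenerators J := by
    rw [minGenerators_eq_finrank_pairSocle_add_one hJ, hz, pairSocle_sub_mul]
  have hlow : ∀ i < s + 1, hilbertFunction J i = i + 1 := fun i hi =>
    hilbertFunction_of_lt (hs ▸ le_maximalIdeal_pow_idealOrder J) hi
  have hanti : ∀ i, s ≤ i → hilbertFunction J (i + 1) ≤ hilbertFunction J i := fun i hi =>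
    finrank_quotient_succ_le hzn hle hi
  have hdrop : ∀ i, s ≤ i → hilbertFunction J i ≤
      hilbertFunction J (i + 1) + finrank k (pairSocle k z w) := fun i hi =>
    finrank_quotient_le_succ_add hzn hwn hle hi
  obtain ⟨N, hN⟩ := exists_hilbertFunction_eq_zero hJ
  refine ⟨⟨ht, hs ▸ hlow, fun i hi => hanti i (by omega), N, hN⟩, ?_, ?_⟩
  · have hpos : 1 ≤ finrank k (pairSocle k z w) := by
      by_contra! h0
      have hall : ∀ j, s + 1 ≤ hilbertFunction J (s + j) := by
        intro j
        induction j with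
        | zero => exact (hlow s (by omega)).ge
        | succ j ih =>
          have := hdrop (s + j) (by omega)
          rw [← add_assoc]
          omega
      have h1 := hall (N + 1)
      rw [hN (s + (N + 1)) (by omega)] at h1
      omega
    have : maxJump (hilbertFunction J) ≤ finrank k (pairSocle k z w) := by
      refine ciSup_le fun i => ?_
      by_cases hi : s ≤ i
      · have h1 := hanti i hi
        have h2 := hdrop i hi
        omega
      · rw [hlow i (by omega), hlow (i + 1) (by omega)]
        omega
    omega
  · have h1 := finrank_pairSocle_le (k := k) hspan exists_sub_algebraMap_mem_maxIdealQuot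
      (hle.trans Ideal.mul_le_left)
    omega

end GeneralLinearForm

/-! ### Power series acting through commuting nilpotent operators -/

section Action

variable {k : Type*} [Field k] {N : Type*} [AddCommGroup N] [Module k N]

open scoped IsMulCommutative in
/-- Two commuting nilpotent endomorphisms define an action of `k[[x, y]]`. -/
theorem exists_algHom_end {S T : Module.End k N} (hST : S * T = T * S) (hS : IsNilpotent S)
    (hT : IsNilpotent T) : ∃ ρ : R k →ₐ[k] Module.End k N,
      ρ (MvPowerSeries.X 0) = S ∧ ρ (MvPowerSeries.X 1) = T := by
  let B := Algebra.adjoin k ({S, T} : Set (Module.End k N))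
  have : IsMulCommutative B := Algebra.isMulCommutative_adjoin k (by
    rintro a (rfl | rfl) b (rfl | rfl)
    exacts [rfl, hST, hST.symm, rfl])
  let S' : B := ⟨S, Algebra.subset_adjoin (by simp)⟩
  let T' : B := ⟨T, Algebra.subset_adjoin (by simp)⟩
  let φ : MvPolynomial (Fin 2) k →ₐ[k] B := MvPolynomial.aeval ![S', T']
  have hnil : ∀ i, IsNilpotent (φ (MvPolynomial.X i)) := by
    have h1 : IsNilpotent S' := by
      obtain ⟨n, hn⟩ := hS
      exact ⟨n, Subtype.ext hn⟩
    have h2 : IsNilpotent T' := by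
      obtain ⟨n, hn⟩ := hT
      exact ⟨n, Subtype.ext hn⟩
    intro i
    rw [MvPolynomial.aeval_X]
    fin_cases i
    exacts [h1, h2]
  have hle : (MvPolynomial.idealOfVars (Fin 2) k).map φ ≤ nilradical B := by
    rw [MvPolynomial.idealOfVars, Ideal.map_span, Ideal.span_le]
    rintro _ ⟨_, ⟨i, rfl⟩, rfl⟩
    exact hnil i
  -- A finitely generated nil ideal is nilpotent, so the polynomial action factors through a
  -- truncation, and power series map to that truncation.
  obtain ⟨n, hn⟩ := (Ideal.FG.isNilpotent_iff_le_nilradical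
    ((MvPolynomial.idealOfVars_fg (σ := Fin 2) (R := k)).map (φ : MvPolynomial (Fin 2) k →+* B))).2
      hle
  have hker : ∀ p ∈ MvPolynomial.idealOfVars (Fin 2) k ^ n, φ p = 0 := by
    intro p hp
    have := Ideal.mem_map_of_mem (φ : MvPolynomial (Fin 2) k →+* B) hp
    rw [Ideal.map_pow] at this
    have h0 := hn ▸ this
    exact h0
  let ψ : (MvPolynomial (Fin 2) k ⧸ MvPolynomial.idealOfVars (Fin 2) k ^ n) →ₐ[k] B :=
    Ideal.Quotient.liftₐ _ φ hker
  let τ : R k →ₐ[k] (MvPolynomial (Fin 2) k ⧸ MvPolynomial.idealOfVars (Fin 2) k ^ n) :=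
    (MvPowerSeries.truncTotalAlgHom (Fin 2) k n).restrictScalars k
  have hτ : ∀ i, τ (MvPowerSeries.X i) = Ideal.Quotient.mk _ (MvPolynomial.X i) := fun i => by
    have := (MvPowerSeries.truncTotalAlgHom (Fin 2) k n).commutes (MvPolynomial.X i)
    rw [MvPowerSeries.algebraMap_apply', Algebra.algebraMap_self, MvPowerSeries.map_id,
      MvPolynomial.coe_X] at this
    exact this
  refine ⟨(B.val.comp ψ).comp τ, ?_, ?_⟩
  · change ((ψ (τ (MvPowerSeries.X 0)) : B) : Module.End k N) = S
    rw [hτ]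
    change ((φ (MvPolynomial.X 0) : B) : Module.End k N) = S
    rw [MvPolynomial.aeval_X]
    rfl
  · change ((ψ (τ (MvPowerSeries.X 1)) : B) : Module.End k N) = T
    rw [hτ]
    change ((φ (MvPolynomial.X 1) : B) : Module.End k N) = T
    rw [MvPolynomial.aeval_X]
    rfl

end Action

/-- The boxes `(a, i)` of the diagram of `h`: in degree `i` there are `h i` of them. -/
abbrev Diagram (h : ℕ → ℕ) : Type := {p : ℕ × ℕ // p.1 < h p.2}

/-- For a nonincreasing tail of `h` from `t` on, the first degree `≥ t` without a box in
column `a`. -/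
noncomputable def colTop (h : ℕ → ℕ) (t a : ℕ) : ℕ := sInf {i | t ≤ i ∧ h i ≤ a}

/-! ### Columns of the diagram of an admissible sequence -/

section Combinatorics

variable {h : ℕ → ℕ} {t : ℕ}

lemma IsAdmissible.antitone_tail (hh : IsAdmissible h t) {i j : ℕ} (hi : t ≤ i + 1) (hij : i ≤ j) :
    h j ≤ h i := by
  induction j, hij using Nat.le_induction with
  | base => exact le_rfl
  | succ j hj ih => exact (hh.2.2.1 j (by omega)).trans ih

lemma IsAdmissible.le_order (hh : IsAdmissible h t) (i : ℕ) : h i ≤ t := by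
  by_cases hi : i < t
  · rw [hh.2.1 i hi]; exact hi
  · have h1 := hh.antitone_tail (i := t - 1) (j := i) (by omega) (by omega)
    have h2 := hh.2.1 (t - 1) (by have := hh.1; omega)
    have := hh.1
    omega

lemma IsAdmissible.le_succ (hh : IsAdmissible h t) (i : ℕ) : h i ≤ i + 1 := by
  by_cases hi : i < t
  · rw [hh.2.1 i hi]
  · exact (hh.le_order i).trans (by omega)

lemma IsAdmissible.colTop_spec (hh : IsAdmissible h t) (a : ℕ) :
    t ≤ colTop h t a ∧ h (colTop h t a) ≤ a := by
  obtain ⟨s, hs⟩ := hh.2.2.2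
  exact Nat.sInf_mem (s := {i | t ≤ i ∧ h i ≤ a})
    ⟨max t (s + 1), le_max_left _ _, by rw [hs _ (by omega)]; exact Nat.zero_le a⟩

/-- Columns have no gaps: `h` first increases by ones, so column `a < t` starts in degree `a`, and
afterwards `h` is nonincreasing. -/
lemma IsAdmissible.lt_iff_lt_colTop (hh : IsAdmissible h t) {a i : ℕ} (hai : a ≤ i) :
    a < h i ↔ i < colTop h t a := by
  obtain ⟨h1, h2⟩ := hh.colTop_spec a
  constructor
  · intro h3
    by_contra! h4
    have := hh.antitone_tail (by omega) h4
    omega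
  · intro h3
    by_contra! h4
    by_cases hi : i < t
    · have := hh.2.1 i hi
      omega
    · exact absurd (Nat.sInf_le (s := {i | t ≤ i ∧ h i ≤ a}) ⟨by omega, h4⟩) (not_le.2 h3)

/-- Needed because a supremum in `ℕ` bounds its terms only when the family is bounded. -/
lemma IsAdmissible.bddAbove_jumps (hh : IsAdmissible h t) :
    BddAbove (Set.range fun i : ℕ => ((h (i + 1) : ℤ) - (h i : ℤ)).natAbs) := by
  refine ⟨t, ?_⟩
  rintro _ ⟨i, rfl⟩
  have h1 := hh.le_order i
  have h2 := hh.le_order (i + 1)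
  dsimp only
  omega

lemma IsAdmissible.le_succ_add_maxJump (hh : IsAdmissible h t) (i : ℕ) :
    h i ≤ h (i + 1) + maxJump h := by
  have h1 : ((h (i + 1) : ℤ) - (h i : ℤ)).natAbs ≤ maxJump h := le_ciSup hh.bddAbove_jumps i
  omega

/-- Otherwise `h` exceeds `a` just below the top of column `a` and is at most `a - δ` at that top, a
drop of at least `δ + 1`. -/
lemma IsAdmissible.colTop_lt (hh : IsAdmissible h t) {δ a : ℕ} (hδ : maxJump h ≤ δ) (hδa : δ ≤ a)
    (ha : a < t) : colTop h t a < colTop h t (a - δ) := by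
  by_contra! hle
  obtain ⟨h1, h2⟩ := hh.colTop_spec (a - δ)
  obtain ⟨h3, -⟩ := hh.colTop_spec a
  have h4 := hh.antitone_tail (by omega) hle
  have h5 : a < h (colTop h t a - 1) :=
    (hh.lt_iff_lt_colTop (by omega)).2 (by omega)
  have h6 := hh.le_succ_add_maxJump (colTop h t a - 1)
  rw [Nat.sub_add_cancel (by omega)] at h6
  omega

lemma IsAdmissible.order_unique (hh : IsAdmissible h t) {t' : ℕ} (hh' : IsAdmissible h t') :
    t = t' := by
  rcases lt_trichotomy t t' with hlt | heq | hlt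
  · have := hh'.2.1 t hlt
    have := hh.le_order t
    omega
  · exact heq
  · have := hh.2.1 t' hlt
    have := hh'.le_order t'
    omega

lemma IsAdmissible.finite_diagram (hh : IsAdmissible h t) : Finite (Diagram h) := by
  obtain ⟨s, hs⟩ := hh.2.2.2
  refine Set.Finite.to_subtype (s := {p : ℕ × ℕ | p.1 < h p.2})
    (((Set.finite_Iic t).prod (Set.finite_Iic s)).subset ?_)
  rintro ⟨a, i⟩ hai
  have hai' : a < h i := hai
  refine ⟨(hai'.trans_le (hh.le_order i)).le, ?_⟩
  change i ≤ s
  by_contra! hi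
  rw [hs i hi] at hai'
  omega

end Combinatorics

/-! ### The box module and its socle -/

section Action

variable (k : Type*) [Field k] (h : ℕ → ℕ) (t δ : ℕ)

/-- The basis vector of the box `(a, i)`, and zero outside the diagram. -/
noncomputable def box (a i : ℕ) : Diagram h →₀ k :=
  if ha : a < h i then Finsupp.single ⟨(a, i), ha⟩ 1 else 0

/-- The action of `y`: it moves a box up in its column. -/
noncomputable def actY : Module.End k (Diagram h →₀ k) :=
  Finsupp.linearCombination k fun p => box k h p.1.1 (p.1.2 + 1)

/-- The action of `x`: it moves a box to the next column, plus a correction `δ` columns back at the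
same distance from the top. -/
noncomputable def actX : Module.End k (Diagram h →₀ k) :=
  Finsupp.linearCombination k fun p => box k h (p.1.1 + 1) (p.1.2 + 1) +
    if δ ≤ p.1.1 then
      box k h (p.1.1 - δ) (p.1.2 + (colTop h t (p.1.1 - δ) - colTop h t p.1.1)) else 0

variable {k h t δ}

lemma box_of_lt {a i : ℕ} (ha : a < h i) : box k h a i = Finsupp.single ⟨(a, i), ha⟩ 1 :=
  dif_pos ha

lemma box_of_le {a i : ℕ} (ha : h i ≤ a) : box k h a i = 0 := dif_neg (not_lt.2 ha)

lemma box_apply (a i : ℕ) (q : Diagram h) : box k h a i q = if q.1 = (a, i) then 1 else 0 := by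
  by_cases ha : a < h i
  · rw [box_of_lt ha, Finsupp.single_apply]
    refine if_congr ?_ rfl rfl
    rw [Subtype.ext_iff, eq_comm]
  · rw [box_of_le (not_lt.1 ha), if_neg]
    · rfl
    · rintro hq
      have := q.2
      rw [hq] at this
      exact ha this

/-- Extends the defining formula to zero boxes above a column. The condition `a ≤ i` excludes the
place just below the start of a column, where the formula would fail. -/
lemma actY_box (hh : IsAdmissible h t) {a i : ℕ} (hai : a ≤ i) :
    actY k h (box k h a i) = box k h a (i + 1) := by
  by_cases ha : a < h i
  · rw [box_of_lt ha, actY, Finsupp.linearCombination_single, one_smul]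
  · rw [box_of_le (not_lt.1 ha), map_zero, box_of_le]
    by_cases hi : i < t
    · have := hh.2.1 i hi
      omega
    · exact (hh.antitone_tail (by omega) (Nat.le_add_right i 1)).trans (not_lt.1 ha)

lemma actX_box (hh : IsAdmissible h t) (hδ : maxJump h ≤ δ) {a i : ℕ} (hai : a ≤ i)
    (hat : a < t) : actX k h t δ (box k h a i) = box k h (a + 1) (i + 1) +
      if δ ≤ a then box k h (a - δ) (i + (colTop h t (a - δ) - colTop h t a)) else 0 := by
  by_cases ha : a < h i
  · rw [box_of_lt ha, actX, Finsupp.linearCombination_single, one_smul]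
  · have hi := (hh.lt_iff_lt_colTop hai).not.1 ha
    have h1 := (hh.colTop_spec a).1
    have h2 := hh.antitone_tail (i := i) (j := i + 1) (by omega) (by omega)
    rw [box_of_le (not_lt.1 ha), map_zero, box_of_le (a := a + 1) (by omega), zero_add]
    split_ifs with hδa
    · have h3 := hh.colTop_lt hδ hδa hat
      rw [box_of_le]
      -- The correction preserves the position relative to the top, so a place above column `a` goes
      -- to a place above column `a - δ`.
      have h4 := (hh.lt_iff_lt_colTop (a := a - δ)
        (i := i + (colTop h t (a - δ) - colTop h t a)) (by omega)).not
      exact not_lt.1 (h4.2 (by omega))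
    · rfl

lemma ext_box {V : Type*} [AddCommGroup V] [Module k V] {f g : (Diagram h →₀ k) →ₗ[k] V}
    (hfg : ∀ a i, a < h i → f (box k h a i) = g (box k h a i)) : f = g := by
  refine Finsupp.lhom_ext' fun p => LinearMap.ext_ring ?_
  have := hfg p.1.1 p.1.2 p.2
  rwa [box_of_lt p.2] at this

lemma actX_mul_actY (hh : IsAdmissible h t) (hδ : maxJump h ≤ δ) :
    actX k h t δ * actY k h = actY k h * actX k h t δ := by
  refine ext_box fun a i ha => ?_
  have hat := ha.trans_le (hh.le_order i)
  have hai : a ≤ i := by have := hh.le_succ i; omega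
  rw [Module.End.mul_apply, Module.End.mul_apply, actY_box hh hai, actX_box hh hδ hai hat,
    actX_box hh hδ (by omega) hat, map_add, actY_box hh (by omega)]
  congr 1
  split_ifs
  · rw [actY_box hh (by omega)]
    congr 1
    omega
  · rw [map_zero]

variable (k h) in
/-- The span of the boxes of degree at least `i`. -/
noncomputable def boxFiltration (i : ℕ) : Submodule k (Diagram h →₀ k) :=
  Finsupp.supported k k {p | i ≤ p.1.2}

lemma box_mem_boxFiltration {a i j : ℕ} (hij : j ≤ i) : box k h a i ∈ boxFiltration k h j := by
  by_cases ha : a < h i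
  · rw [box_of_lt ha]
    exact Finsupp.single_mem_supported k 1 hij
  · rw [box_of_le (not_lt.1 ha)]
    exact zero_mem _

lemma boxFiltration_zero : boxFiltration k h 0 = ⊤ := by
  rw [boxFiltration, ← Finsupp.supported_univ]
  congr 1
  ext
  simp

lemma boxFiltration_le_iff {V : Submodule k (Diagram h →₀ k)} {i : ℕ} :
    boxFiltration k h i ≤ V ↔ ∀ a j, i ≤ j → a < h j → box k h a j ∈ V := by
  rw [boxFiltration, Finsupp.supported_eq_span_single, Submodule.span_le]
  constructor
  · intro hV a j hij ha
    rw [box_of_lt ha]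
    exact hV ⟨⟨(a, j), ha⟩, hij, rfl⟩
  · rintro hV _ ⟨p, hp, rfl⟩
    have := hV p.1.1 p.1.2 hp p.2
    rwa [box_of_lt p.2] at this

lemma boxFiltration_le_comap_actY (i : ℕ) :
    boxFiltration k h i ≤ (boxFiltration k h (i + 1)).comap (actY k h) := by
  refine boxFiltration_le_iff.2 fun a j hij ha => ?_
  rw [Submodule.mem_comap, box_of_lt ha, actY, Finsupp.linearCombination_single, one_smul]
  exact box_mem_boxFiltration (by dsimp only; omega)

lemma boxFiltration_le_comap_actX (hh : IsAdmissible h t) (hδ : maxJump h ≤ δ) (i : ℕ) :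
    boxFiltration k h i ≤ (boxFiltration k h (i + 1)).comap (actX k h t δ) := by
  refine boxFiltration_le_iff.2 fun a j hij ha => ?_
  have hat := ha.trans_le (hh.le_order j)
  rw [Submodule.mem_comap, actX_box hh hδ (by have := hh.le_succ j; omega) hat]
  refine add_mem (box_mem_boxFiltration (by omega)) ?_
  split_ifs with hδa
  · have := hh.colTop_lt hδ hδa hat
    exact box_mem_boxFiltration (by omega)
  · exact zero_mem _

lemma exists_boxFiltration_eq_bot (hh : IsAdmissible h t) : ∃ s, boxFiltration k h s = ⊥ := by
  obtain ⟨s, hs⟩ := hh.2.2.2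
  refine ⟨s + 1, eq_bot_iff.2 (boxFiltration_le_iff.2 fun a j hj ha => ?_)⟩
  rw [hs j (by omega)] at ha
  omega

lemma isNilpotent_of_boxFiltration (hh : IsAdmissible h t) {f : Module.End k (Diagram h →₀ k)}
    (hf : ∀ i, boxFiltration k h i ≤ (boxFiltration k h (i + 1)).comap f) : IsNilpotent f := by
  obtain ⟨s, hs⟩ := exists_boxFiltration_eq_bot (k := k) hh
  refine ⟨s, LinearMap.ext fun v => ?_⟩
  have : ∀ i, (f ^ i) v ∈ boxFiltration k h i := by
    intro i
    induction i with
    | zero => rw [boxFiltration_zero]; trivial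
    | succ i ih =>
      rw [pow_succ', Module.End.mul_apply]
      exact hf i ih
  have h1 := this s
  rw [hs] at h1
  exact h1

lemma finrank_boxFiltration (hh : IsAdmissible h t) (i : ℕ) :
    finrank k (boxFiltration k h i) = h i + finrank k (boxFiltration k h (i + 1)) := by
  have := hh.finite_diagram
  let L : (Diagram h →₀ k) →ₗ[k] (Fin (h i) → k) :=
    LinearMap.pi fun a => Finsupp.lapply ⟨(a, i), a.2⟩
  have h1 := finrank_map_add_finrank_inf_ker L (boxFiltration k h i)
  have h2 : (boxFiltration k h i).map L = ⊤ := by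
    rw [eq_top_iff]
    intro v _
    refine ⟨∑ a : Fin (h i), v a • box k h a i, sum_mem fun a _ =>
      Submodule.smul_mem _ _ (box_mem_boxFiltration le_rfl), ?_⟩
    ext b
    change (∑ a : Fin (h i), v a • box k h a i : Diagram h →₀ k) ⟨(b, i), b.2⟩ = v b
    rw [Finsupp.finsetSum_apply, Finset.sum_eq_single b]
    · rw [Finsupp.smul_apply, box_apply, if_pos rfl, smul_eq_mul, mul_one]
    · intro a _ hab
      rw [Finsupp.smul_apply, box_apply, if_neg, smul_zero]
      rintro h0
      exact hab (Fin.ext (congrArg Prod.fst h0).symm)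
    · simp
  have h3 : boxFiltration k h i ⊓ LinearMap.ker L = boxFiltration k h (i + 1) := by
    ext f
    rw [Submodule.mem_inf, boxFiltration, boxFiltration, Finsupp.mem_supported',
      Finsupp.mem_supported']
    constructor
    · rintro ⟨hf, hf'⟩ ⟨⟨a, j⟩, ha⟩ hj
      by_cases hji : i ≤ j
      · have hj' : ¬ i + 1 ≤ j := hj
        obtain rfl : j = i := by omega
        exact congrFun hf' ⟨a, ha⟩
      · exact hf _ hji
    · intro hf
      refine ⟨fun p hp => hf p fun hp' => hp ?_, ?_⟩
      · have : i + 1 ≤ p.1.2 := hp'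
        change i ≤ p.1.2
        omega
      · ext a
        refine hf _ ?_
        change ¬ i + 1 ≤ i
        omega
  rw [h2, h3, finrank_top, finrank_fintype_fun_eq_card, Fintype.card_fin] at h1
  exact h1.symm

/-- The place one column on and one degree up is outside the diagram, so only the correction
survives, and it carries tops to tops. -/
lemma actX_boxTop (hh : IsAdmissible h t) (hδ : maxJump h ≤ δ) {a : ℕ} (hat : a < t) :
    actX k h t δ (box k h a (colTop h t a - 1)) =
      if δ ≤ a then box k h (a - δ) (colTop h t (a - δ) - 1) else 0 := by
  obtain ⟨h1, h2⟩ := hh.colTop_spec a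
  rw [actX_box hh hδ (by omega) hat, box_of_le (a := a + 1), zero_add]
  · split_ifs with hδa
    · have := hh.colTop_lt hδ hδa hat
      congr 1
      omega
    · rfl
  · rw [Nat.sub_add_cancel (by omega)]
    omega

lemma actY_boxTop (hh : IsAdmissible h t) {a : ℕ} (hat : a < t) :
    actY k h (box k h a (colTop h t a - 1)) = 0 := by
  obtain ⟨h1, h2⟩ := hh.colTop_spec a
  rw [actY_box hh (by omega), Nat.sub_add_cancel (by omega), box_of_le h2]

/-- Boxes below the top of their column have distinct nonzero images under `y`, so the kernel of `y`
is supported on tops. -/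
lemma eq_zero_of_actY_eq_zero (hh : IsAdmissible h t) {f : Diagram h →₀ k}
    (hf : actY k h f = 0) (p : Diagram h) (hp : p.1.2 + 1 ≠ colTop h t p.1.1) : f p = 0 := by
  obtain ⟨⟨a, i⟩, ha⟩ := p
  have ha' : a < h i := ha
  have hat : a < t := ha'.trans_le (hh.le_order i)
  have hai : a ≤ i := by have := hh.le_succ i; omega
  have hi := (hh.lt_iff_lt_colTop hai).1 ha'
  have hp' : i + 1 ≠ colTop h t a := hp
  have hq : a < h (i + 1) := (hh.lt_iff_lt_colTop (by omega)).2 (by omega)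
  have h1 := DFunLike.congr_fun hf ⟨(a, i + 1), hq⟩
  rw [actY, Finsupp.linearCombination_apply, Finsupp.sum_apply, Finsupp.sum,
    Finset.sum_eq_single ⟨(a, i), ha⟩] at h1
  · rw [Finsupp.smul_apply, box_apply, if_pos rfl, smul_eq_mul, mul_one] at h1
    exact h1
  · rintro ⟨⟨b, j⟩, hb⟩ _ hne
    rw [Finsupp.smul_apply, box_apply, if_neg, smul_zero]
    intro h0
    apply hne
    simp only [Prod.mk.injEq, Subtype.mk.injEq] at h0 ⊢
    omega
  · intro h0
    rw [Finsupp.notMem_support_iff.1 h0, zero_smul]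
    rfl

/-- On the kernel of `y` only tops occur, and `x` sends tops of columns `a ≥ δ` to distinct tops;
the coefficient at the target isolates `f p`. -/
lemma eq_zero_of_actX_eq_zero (hh : IsAdmissible h t) (hδ : maxJump h ≤ δ) {f : Diagram h →₀ k}
    (hfY : actY k h f = 0) (hfX : actX k h t δ f = 0) (p : Diagram h) (hp : δ ≤ p.1.1) :
    f p = 0 := by
  by_cases hp1 : p.1.2 + 1 = colTop h t p.1.1
  swap
  · exact eq_zero_of_actY_eq_zero hh hfY p hp1
  have hpt : p.1.1 < t := p.2.trans_le (hh.le_order _)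
  have hlt := hh.colTop_lt hδ hp hpt
  have htop := (hh.colTop_spec (p.1.1 - δ)).1
  have hq : p.1.1 - δ < h (colTop h t (p.1.1 - δ) - 1) :=
    (hh.lt_iff_lt_colTop (by omega)).2 (by omega)
  have key : ∀ r : Diagram h, f r • actX k h t δ (box k h r.1.1 r.1.2) =
      f r • if δ ≤ r.1.1 then box k h (r.1.1 - δ) (colTop h t (r.1.1 - δ) - 1) else 0 := by
    intro r
    by_cases hr : r.1.2 + 1 = colTop h t r.1.1
    · rw [← actX_boxTop hh hδ (r.2.trans_le (hh.le_order _)), ← hr, Nat.add_sub_cancel]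
    · rw [eq_zero_of_actY_eq_zero hh hfY r hr, zero_smul, zero_smul]
  have hsum : actX k h t δ f = f.sum fun r c => c •
      (if δ ≤ r.1.1 then box k h (r.1.1 - δ) (colTop h t (r.1.1 - δ) - 1) else 0) := by
    conv_lhs => rw [← Finsupp.sum_single f]
    rw [Finsupp.sum, map_sum]
    refine Finset.sum_congr rfl fun r _ => ?_
    refine Eq.trans ?_ (key r)
    rw [box_of_lt r.2, ← map_smul, Finsupp.smul_single, smul_eq_mul, mul_one]
  have h1 := DFunLike.congr_fun (hsum.symm.trans hfX) ⟨(p.1.1 - δ, colTop h t (p.1.1 - δ) - 1), hq⟩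
  rw [Finsupp.sum_apply, Finsupp.sum, Finset.sum_eq_single p] at h1
  · rw [if_pos hp, Finsupp.smul_apply, box_apply, if_pos rfl, smul_eq_mul, mul_one] at h1
    exact h1
  · intro r _ hne
    rw [Finsupp.smul_apply]
    split_ifs with hr
    · by_cases hr1 : r.1.2 + 1 = colTop h t r.1.1
      · rw [box_apply, if_neg, smul_zero]
        intro h0
        apply hne
        simp only [Prod.mk.injEq] at h0
        have h2 : r.1.1 = p.1.1 := by omega
        have h3 : r.1.2 = p.1.2 := by rw [h2] at hr1; omega
        exact Subtype.ext (Prod.ext h2 h3)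
      · rw [eq_zero_of_actY_eq_zero hh hfY r hr1, zero_smul]
    · rw [Finsupp.zero_apply, smul_zero]
  · intro h0
    rw [Finsupp.notMem_support_iff.1 h0, zero_smul]
    rfl

/-- Reading off coefficients at the tops of columns `0, …, δ - 1` is an isomorphism on the socle; `δ
≤ t` ensures that these columns are nonempty. -/
lemma finrank_ker_actX_inf_ker_actY (hh : IsAdmissible h t) (hδ : maxJump h ≤ δ) (hδt : δ ≤ t) :
    finrank k ↥(LinearMap.ker (actX k h t δ) ⊓ LinearMap.ker (actY k h)) = δ := by
  have := hh.finite_diagram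
  have hmem : ∀ a : Fin δ, (a : ℕ) < h (colTop h t a - 1) := fun a => by
    have := (hh.colTop_spec (a : ℕ)).1
    have := a.2
    exact (hh.lt_iff_lt_colTop (by omega)).2 (by omega)
  let G : (Diagram h →₀ k) →ₗ[k] (Fin δ → k) :=
    LinearMap.pi fun a => Finsupp.lapply ⟨(a, colTop h t a - 1), hmem a⟩
  set K := LinearMap.ker (actX k h t δ) ⊓ LinearMap.ker (actY k h) with hK
  have h1 := finrank_map_add_finrank_inf_ker G K
  have h2 : K.map G = ⊤ := by
    rw [eq_top_iff]
    intro v _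
    refine ⟨∑ a : Fin δ, v a • box k h a (colTop h t a - 1), sum_mem fun a _ =>
      Submodule.smul_mem _ _ ⟨?_, ?_⟩, ?_⟩
    · rw [SetLike.mem_coe, LinearMap.mem_ker, actX_boxTop hh hδ (by omega), if_neg (by omega)]
    · rw [SetLike.mem_coe, LinearMap.mem_ker, actY_boxTop hh (by omega)]
    · ext b
      change (∑ a : Fin δ, v a • box k h a (colTop h t a - 1) : Diagram h →₀ k)
        ⟨(b, colTop h t b - 1), hmem b⟩ = v b
      rw [Finsupp.finsetSum_apply, Finset.sum_eq_single b]
      · rw [Finsupp.smul_apply, box_apply, if_pos rfl, smul_eq_mul, mul_one]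
      · intro a _ hab
        rw [Finsupp.smul_apply, box_apply, if_neg, smul_zero]
        rintro h0
        exact hab (Fin.ext (congrArg Prod.fst h0).symm)
      · simp
  have h3 : K ⊓ LinearMap.ker G = ⊥ := by
    rw [eq_bot_iff]
    rintro f ⟨⟨hfX, hfY⟩, hfG⟩
    rw [Submodule.mem_bot]
    ext p
    by_cases hp : δ ≤ p.1.1
    · exact eq_zero_of_actX_eq_zero hh hδ hfY hfX p hp
    · by_cases hp1 : p.1.2 + 1 = colTop h t p.1.1
      · have h4 := congrFun hfG ⟨p.1.1, not_le.1 hp⟩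
        have h5 : (⟨(p.1.1, colTop h t p.1.1 - 1), hmem ⟨p.1.1, not_le.1 hp⟩⟩ : Diagram h) = p :=
          Subtype.ext (Prod.ext rfl (by dsimp only; omega))
        have h6 : f ⟨(p.1.1, colTop h t p.1.1 - 1), hmem ⟨p.1.1, not_le.1 hp⟩⟩ = 0 := h4
        rwa [h5] at h6
      · exact eq_zero_of_actY_eq_zero hh hfY p hp1
  rw [h2, h3, finrank_top, finrank_bot, add_zero, finrank_fintype_fun_eq_card,
    Fintype.card_fin] at h1
  exact h1.symm

end Action

end PowerSeriesIdeal

namespace PowerSeriesIdeal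

open Module MvPowerSeries

/-! ### Cyclic modules and the ideal with prescribed invariants -/

section Realization

variable {k : Type*} [Field k] {N : Type*} [AddCommGroup N] [Module k N]

/-- The annihilator of a vector under an action of `k[[x, y]]`. -/
def vectorAnnihilator (ρ : R k →ₐ[k] Module.End k N) (v : N) : Ideal (R k) where
  carrier := {f | ρ f v = 0}
  add_mem' {f g} hf hg := by
    change ρ (f + g) v = 0
    have hf' : ρ f v = 0 := hf
    have hg' : ρ g v = 0 := hg
    rw [map_add, LinearMap.add_apply, hf', hg', add_zero]
  zero_mem' := by
    change ρ 0 v = 0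
    rw [map_zero, LinearMap.zero_apply]
  smul_mem' g f hf := by
    change ρ (g * f) v = 0
    have hf' : ρ f v = 0 := hf
    rw [map_mul, Module.End.mul_apply, hf', map_zero]

/-- The orbit map of a vector. -/
noncomputable def orbitMap (ρ : R k →ₐ[k] Module.End k N) (v : N) : R k →ₗ[k] N :=
  (LinearMap.applyₗ v) ∘ₗ ρ.toLinearMap

lemma orbitMap_apply (ρ : R k →ₐ[k] Module.End k N) (v : N) (f : R k) :
    orbitMap ρ v f = ρ f v := rfl

lemma orbitMap_mul (ρ : R k →ₐ[k] Module.End k N) (v : N) (f g : R k) :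
    orbitMap ρ v (f * g) = ρ f (orbitMap ρ v g) := by
  rw [orbitMap_apply, map_mul]
  rfl

/-- A cyclic module over `k[[x, y]]` is the quotient by the annihilator of a generator. -/
noncomputable def orbitEquiv (ρ : R k →ₐ[k] Module.End k N) (v : N)
    (hv : Function.Surjective (orbitMap ρ v)) :
    (R k ⧸ vectorAnnihilator ρ v) ≃ₗ[k] N :=
  (Submodule.Quotient.restrictScalarsEquiv k (vectorAnnihilator ρ v)).symm ≪≫ₗ
    (Submodule.quotEquivOfEq _ _ (by ext; rfl)) ≪≫ₗ (orbitMap ρ v).quotKerEquivOfSurjective hv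

lemma orbitEquiv_mk (ρ : R k →ₐ[k] Module.End k N) (v : N)
    (hv : Function.Surjective (orbitMap ρ v)) (f : R k) :
    orbitEquiv ρ v hv (Ideal.Quotient.mk _ f) = ρ f v := rfl

lemma orbitEquiv_mk_mul (ρ : R k →ₐ[k] Module.End k N) (v : N)
    (hv : Function.Surjective (orbitMap ρ v)) (f : R k) (a : R k ⧸ vectorAnnihilator ρ v) :
    orbitEquiv ρ v hv (Ideal.Quotient.mk _ f * a) = ρ f (orbitEquiv ρ v hv a) := by
  obtain ⟨g, rfl⟩ := Ideal.Quotient.mk_surjective a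
  rw [← map_mul, orbitEquiv_mk, orbitEquiv_mk, map_mul, Module.End.mul_apply]

lemma finrank_pairSocle_vectorAnnihilator (ρ : R k →ₐ[k] Module.End k N) (v : N)
    (hv : Function.Surjective (orbitMap ρ v)) :
    finrank k (pairSocle k (Ideal.Quotient.mk (vectorAnnihilator ρ v) (X 0))
      (Ideal.Quotient.mk (vectorAnnihilator ρ v) (X 1))) =
      finrank k ↥(LinearMap.ker (ρ (X 0)) ⊓ LinearMap.ker (ρ (X 1))) := by
  rw [← LinearEquiv.finrank_map_eq (orbitEquiv ρ v hv)]
  refine congrArg (fun P : Submodule k N => finrank k P) ?_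
  ext u
  constructor
  · rintro ⟨a, ⟨h0, h1⟩, rfl⟩
    have h0' : Ideal.Quotient.mk (vectorAnnihilator ρ v) (X 0) * a = 0 := h0
    have h1' : Ideal.Quotient.mk (vectorAnnihilator ρ v) (X 1) * a = 0 := h1
    refine ⟨?_, ?_⟩
    · change ρ (X 0) (orbitEquiv ρ v hv a) = 0
      rw [← orbitEquiv_mk_mul, h0', map_zero]
    · change ρ (X 1) (orbitEquiv ρ v hv a) = 0
      rw [← orbitEquiv_mk_mul, h1', map_zero]
  · rintro ⟨h0, h1⟩
    obtain ⟨a, rfl⟩ := (orbitEquiv ρ v hv).surjective u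
    refine ⟨a, ⟨?_, ?_⟩, rfl⟩
    · apply (orbitEquiv ρ v hv).injective
      rw [map_zero]
      exact (orbitEquiv_mk_mul ρ v hv (X 0) a).trans h0
    · apply (orbitEquiv ρ v hv).injective
      rw [map_zero]
      exact (orbitEquiv_mk_mul ρ v hv (X 1) a).trans h1

lemma finrank_maxIdealQuot_pow_vectorAnnihilator (ρ : R k →ₐ[k] Module.End k N) (v : N)
    (hv : Function.Surjective (orbitMap ρ v)) (i : ℕ) :
    finrank k ↥(maxIdealQuot (vectorAnnihilator ρ v) ^ i) =
      finrank k (((IsLocalRing.maximalIdeal (R k) ^ i).restrictScalars k).map (orbitMap ρ v)) := by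
  have h := LinearEquiv.finrank_map_eq (orbitEquiv ρ v hv)
    ((maxIdealQuot (vectorAnnihilator ρ v) ^ i).restrictScalars k)
  refine h.symm.trans ?_
  refine congrArg (fun P : Submodule k N => finrank k P) ?_
  ext u
  constructor
  · rintro ⟨a, ha, rfl⟩
    obtain ⟨f, hf, rfl⟩ := (mem_maxIdealQuot_pow_iff i a).1 ha
    exact ⟨f, hf, rfl⟩
  · rintro ⟨f, hf, rfl⟩
    exact ⟨Ideal.Quotient.mk _ f, mk_mem_maxIdealQuot_pow hf, rfl⟩

variable {h : ℕ → ℕ} {t δ : ℕ}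

/-- In degree zero this says that the box `(0, 0)` generates; in general it turns the Hilbert
function into a count of boxes by degree. -/
lemma map_orbitMap_maximalIdeal_pow (hh : IsAdmissible h t) (hδ : maxJump h ≤ δ)
    {ρ : R k →ₐ[k] Module.End k (Diagram h →₀ k)} (hX : ρ (X 0) = actX k h t δ)
    (hY : ρ (X 1) = actY k h) (i : ℕ) :
    ((IsLocalRing.maximalIdeal (R k) ^ i).restrictScalars k).map (orbitMap ρ (box k h 0 0)) =
      boxFiltration k h i := by
  set v := box k h 0 0
  set M : ℕ → Submodule k (Diagram h →₀ k) := fun i =>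
    ((IsLocalRing.maximalIdeal (R k) ^ i).restrictScalars k).map (orbitMap ρ v) with hM
  have hanti : ∀ {i j}, i ≤ j → M j ≤ M i := fun hij =>
    Submodule.map_mono fun f hf => Ideal.pow_le_pow_right hij hf
  have hMX : ∀ i u, u ∈ M i → actX k h t δ u ∈ M (i + 1) := by
    rintro i _ ⟨f, hf, rfl⟩
    refine ⟨X 0 * f, ?_, by rw [orbitMap_mul, hX]⟩
    change X 0 * f ∈ IsLocalRing.maximalIdeal (R k) ^ (i + 1)
    rw [pow_succ']
    exact Ideal.mul_mem_mul (maximalIdeal_eq_span (k := k) ▸ Ideal.subset_span (by simp)) hf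
  have hMY : ∀ i u, u ∈ M i → actY k h u ∈ M (i + 1) := by
    rintro i _ ⟨f, hf, rfl⟩
    refine ⟨X 1 * f, ?_, by rw [orbitMap_mul, hY]⟩
    change X 1 * f ∈ IsLocalRing.maximalIdeal (R k) ^ (i + 1)
    rw [pow_succ']
    exact Ideal.mul_mem_mul (maximalIdeal_eq_span (k := k) ▸ Ideal.subset_span (by simp)) hf
  have hcol : ∀ a i l, a ≤ i → box k h a i ∈ M i → box k h a (i + l) ∈ M (i + l) := by
    intro a i l hai hmem
    induction l with
    | zero => exact hmem
    | succ l ih =>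
      have := hMY _ _ ih
      rwa [actY_box hh (by omega)] at this
  have hbox : ∀ i a, a ≤ i → box k h a i ∈ M i := by
    intro i
    induction i with
    | zero =>
      intro a ha
      obtain rfl : a = 0 := by omega
      exact ⟨1, by simp, by rw [orbitMap_apply, map_one]; rfl⟩
    | succ i ih =>
      intro a ha
      by_cases hai : a ≤ i
      · exact hcol a i 1 hai (ih a hai)
      obtain rfl : a = i + 1 := by omega
      by_cases hit : i < t
      · have h1 := hMX _ _ (ih i le_rfl)
        rw [actX_box hh hδ le_rfl hit] at h1
        -- The new diagonal box is the image under `x` of the previous one minus the correction,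
        -- which lies in an earlier column already reached and in degree at least `i + 1`.
        refine (Submodule.add_mem_iff_left _ ?_).1 h1
        split_ifs with hδi
        · have h2 := hh.colTop_lt hδ hδi hit
          exact hanti (by omega) (hcol (i - δ) i _ (by omega) (ih (i - δ) (by omega)))
        · exact zero_mem _
      · rw [box_of_le ((hh.le_order (i + 1)).trans (by omega))]
        exact zero_mem _
  apply le_antisymm
  · rintro _ ⟨f, hf, rfl⟩
    have hf' : f ∈ IsLocalRing.maximalIdeal (R k) ^ i := hf
    clear hf
    induction i generalizing f with
    | zero => rw [boxFiltration_zero]; trivial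
    | succ i ih =>
      rw [pow_succ', maximalIdeal_eq_span, mem_span_pair_mul_iff, ← maximalIdeal_eq_span] at hf'
      obtain ⟨g, hg, g', hg', rfl⟩ := hf'
      rw [map_add, orbitMap_mul, orbitMap_mul, hX, hY]
      exact add_mem (boxFiltration_le_comap_actX hh hδ i (ih g hg))
        (boxFiltration_le_comap_actY i (ih g' hg'))
  · refine boxFiltration_le_iff.2 fun a j hij ha => hanti hij (hbox j a ?_)
    have := hh.le_succ j
    omega

theorem exists_ideal_of_isAdmissible [Infinite k] (hh : IsAdmissible h t) {d : ℕ}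
    (hd : maxJump h < d) (hdt : d ≤ t + 1) : ∃ J : Ideal (R k), IsZeroDimensional J ∧
      hilbertFunction J = h ∧ idealOrder J = t ∧ minGenerators J = d := by
  obtain ⟨δ, rfl⟩ : ∃ δ, d = δ + 1 := ⟨d - 1, by omega⟩
  have hδ : maxJump h ≤ δ := by omega
  have := hh.finite_diagram
  obtain ⟨ρ, hX, hY⟩ := exists_algHom_end (k := k) (actX_mul_actY hh hδ)
    (isNilpotent_of_boxFiltration hh (boxFiltration_le_comap_actX hh hδ))
    (isNilpotent_of_boxFiltration hh boxFiltration_le_comap_actY)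
  set v := box k h 0 0 with hv
  have hmap := map_orbitMap_maximalIdeal_pow hh hδ hX hY
  have hsurj : Function.Surjective (orbitMap ρ v) := by
    have h0 := hmap 0
    rw [boxFiltration_zero, pow_zero, Ideal.one_eq_top, Submodule.restrictScalars_top,
      Submodule.map_top] at h0
    exact LinearMap.range_eq_top.1 h0
  set J := vectorAnnihilator ρ v with hJ
  have hfin : Module.Finite k (R k ⧸ J) := Module.Finite.equiv (orbitEquiv ρ v hsurj).symm
  have hzero : IsZeroDimensional J := by
    refine ⟨fun htop => ?_, hfin⟩
    have h1 : (1 : R k) ∈ J := htop ▸ Submodule.mem_top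
    have h2 : ρ 1 v = 0 := h1
    have h3 : 0 < h 0 := by rw [hh.2.1 0 hh.1]; exact one_pos
    rw [map_one, Module.End.one_apply, hv, box_of_lt h3, Finsupp.single_eq_zero] at h2
    exact one_ne_zero h2
  have hHF : hilbertFunction J = h := by
    ext i
    have h1 := hilbertFunction_add_finrank (J := J) i
    rw [finrank_maxIdealQuot_pow_vectorAnnihilator ρ v hsurj,
      finrank_maxIdealQuot_pow_vectorAnnihilator ρ v hsurj, hmap, hmap,
      finrank_boxFiltration hh i] at h1
    omega
  refine ⟨J, hzero, hHF, ?_, ?_⟩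
  -- The order is read off the Hilbert function: the bounds make `h` admissible of order `idealOrder
  -- J`, and the order of an admissible sequence is unique.
  · have h1 := (isAdmissible_and_bounds hzero).1
    rw [hHF] at h1
    exact h1.order_unique hh
  · rw [minGenerators_eq_finrank_pairSocle_add_one hzero,
      finrank_pairSocle_vectorAnnihilator ρ v hsurj, hX, hY,
      finrank_ker_actX_inf_ker_actY hh hδ (by omega)]

end Realization

end PowerSeriesIdeal

theorem mainTheorem5 {k : Type*} [Field k] [CharZero k] (h : ℕ → ℕ) :
    (∀ J : Ideal (PowerSeriesIdeal.R k),
      PowerSeriesIdeal.IsZeroDimensional J → PowerSeriesIdeal.hilbertFunction J = h →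
        PowerSeriesIdeal.IsAdmissible h (PowerSeriesIdeal.idealOrder J) ∧
        PowerSeriesIdeal.maxJump h < PowerSeriesIdeal.minGenerators J ∧
        PowerSeriesIdeal.minGenerators J ≤ PowerSeriesIdeal.idealOrder J + 1) ∧
    (∀ t : ℕ, PowerSeriesIdeal.IsAdmissible h t →
      ∀ d : ℕ, PowerSeriesIdeal.maxJump h < d → d ≤ t + 1 →
        ∃ J : Ideal (PowerSeriesIdeal.R k),
          PowerSeriesIdeal.IsZeroDimensional J ∧ PowerSeriesIdeal.hilbertFunction J = h ∧
          PowerSeriesIdeal.idealOrder J = t ∧ PowerSeriesIdeal.minGenerators J = d) := by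
  refine ⟨fun J hJ hh => ?_, fun t hh d hd hdt =>
    PowerSeriesIdeal.exists_ideal_of_isAdmissible hh hd hdt⟩
  subst hh
  exact PowerSeriesIdeal.isAdmissible_and_bounds hJ
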